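/- The unary-negation fragment UNFO of first-order logic is given by the grammar $$\varphi ::= R(\bar x) \mid x=y \mid \varphi\wedge\varphi \mid \varphi\vee\varphi \mid \exists x\,\varphi \mid \neg\varphi(x),$$ where $R$ ranges over the relation symbols of a relational signature and where, in the last clause, $\varphi$ has no free variables besides (possibly) $x$. The negation depth of a formula is the maximal nesting depth of negations in it. A problem is 2EXPTIME-hard if every language (over a finite alphabet) that a deterministic Turing machine decides in time $2^{2^{p(n)}}$, for some polynomial $p$, is many-one reducible to it in polynomial time; formulas are given as strings in the usual way (the index of a variable may even be written in unary). Structures have nonempty domains. **Proposition.** There is a fixed finite relational signature $\sigma$, consisting of one binary relation symbol $R$ and finitely many unary relation symbols, such that the satisfiability problem for UNFO sentences over $\sigma$ is 2EXPTIME-hard on arbitrary $\sigma$-structures, on finite $\sigma$-structures, and on finite trees (that is, finite $\sigma$-structures in which $R$ is the child relation of a rooted tree). Moreover, for every class $\mathcal K$ of $\sigma$-structures that contains all finite trees, the problem whether a given UNFO sentence over $\sigma$ of negation depth $2$ is true in some structure from $\mathcal K$ is 2EXPTIME-hard. -/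

import Mathlib

namespace UnaryNegation

/-! ### First-order formulas and the unary-negation fragment -/

/-- First-order formulas over a relational signature `σ`, with variables `x₀, x₁, x₂, …` named by
natural numbers and with primitive connectives `∧`, `∨`, `∃`, `¬`. -/
inductive FOFormula (σ : FirstOrder.Language.{0, 0}) : Type
  | rel {n : ℕ} (R : σ.Relations n) (x : Fin n → ℕ) : FOFormula σ
  | eq (x y : ℕ) : FOFormula σ
  | and (φ ψ : FOFormula σ) : FOFormula σ
  | or (φ ψ : FOFormula σ) : FOFormula σ
  | ex (x : ℕ) (φ : FOFormula σ) : FOFormula σ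
  | neg (φ : FOFormula σ) : FOFormula σ

namespace FOFormula

variable {σ : FirstOrder.Language.{0, 0}}

/-- The set of free variables. -/
def freeVars : FOFormula σ → Finset ℕ
  | rel _ x => Finset.univ.image x
  | eq x y => {x, y}
  | and φ ψ => φ.freeVars ∪ ψ.freeVars
  | or φ ψ => φ.freeVars ∪ ψ.freeVars
  | ex x φ => φ.freeVars.erase x
  | neg φ => φ.freeVars

/-- Membership in the unary-negation fragment: only subformulas with at most one free variable
are negated. -/
def IsUNFO : FOFormula σ → Prop
  | rel _ _ => True
  | eq _ _ => True
  | and φ ψ => φ.IsUNFO ∧ ψ.IsUNFO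
  | or φ ψ => φ.IsUNFO ∧ ψ.IsUNFO
  | ex _ φ => φ.IsUNFO
  | neg φ => φ.IsUNFO ∧ φ.freeVars.card ≤ 1

/-- The maximal nesting depth of negations. -/
def negDepth : FOFormula σ → ℕ
  | rel _ _ => 0
  | eq _ _ => 0
  | and φ ψ => max φ.negDepth ψ.negDepth
  | or φ ψ => max φ.negDepth ψ.negDepth
  | ex _ φ => φ.negDepth
  | neg φ => φ.negDepth + 1

/-- Truth of a formula in a `σ`-structure `M` under an assignment `v` of the variables. -/
def Realize {M : Type} [σ.Structure M] : FOFormula σ → (ℕ → M) → Prop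
  | rel R x, v => FirstOrder.Language.Structure.RelMap R (fun i => v (x i))
  | eq x y, v => v x = v y
  | and φ ψ, v => φ.Realize v ∧ ψ.Realize v
  | or φ ψ, v => φ.Realize v ∨ ψ.Realize v
  | ex x φ, v => ∃ a : M, φ.Realize (Function.update v x a)
  | neg φ, v => ¬ φ.Realize v

end FOFormula

/-! ### Formulas as strings -/

/-- The alphabet in which formulas are written: one letter for each relation symbol, for equality,
and for each of the connectives, and two letters for writing variables. -/
inductive Token (σ : FirstOrder.Language.{0, 0}) : Type
  | rel (R : Σ n, σ.Relations n) : Token σ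
  | eq : Token σ
  | and : Token σ
  | or : Token σ
  | ex : Token σ
  | neg : Token σ
  | tick : Token σ
  | dot : Token σ

/-- The alphabet is finite when the signature is. -/
instance Token.instFinite (σ : FirstOrder.Language.{0, 0}) [Finite (Σ n, σ.Relations n)] :
    Finite (Token σ) := by
  let g : (Σ n, σ.Relations n) ⊕ Fin 7 → Token σ
    | .inl R => .rel R
    | .inr 0 => .eq
    | .inr 1 => .and
    | .inr 2 => .or
    | .inr 3 => .ex
    | .inr 4 => .neg
    | .inr 5 => .tick
    | .inr 6 => .dot
  refine Finite.of_surjective g fun t => ?_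
  cases t with
  | rel R => exact ⟨.inl R, rfl⟩
  | eq => exact ⟨.inr 0, rfl⟩
  | and => exact ⟨.inr 1, rfl⟩
  | or => exact ⟨.inr 2, rfl⟩
  | ex => exact ⟨.inr 3, rfl⟩
  | neg => exact ⟨.inr 4, rfl⟩
  | tick => exact ⟨.inr 5, rfl⟩
  | dot => exact ⟨.inr 6, rfl⟩

/-- The variable `x_k`, written with its index in unary. -/
def encodeVar (σ : FirstOrder.Language.{0, 0}) (k : ℕ) : List (Token σ) :=
  List.replicate k Token.tick ++ [Token.dot]

/-- Formulas as strings, in prefix notation. -/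
def FOFormula.encode {σ : FirstOrder.Language.{0, 0}} : FOFormula σ → List (Token σ)
  | .rel (n := n) R x => Token.rel ⟨n, R⟩ :: (List.ofFn fun i => encodeVar σ (x i)).flatten
  | .eq x y => Token.eq :: (encodeVar σ x ++ encodeVar σ y)
  | .and φ ψ => Token.and :: (φ.encode ++ ψ.encode)
  | .or φ ψ => Token.or :: (φ.encode ++ ψ.encode)
  | .ex x φ => Token.ex :: (encodeVar σ x ++ φ.encode)
  | .neg φ => Token.neg :: φ.encode

/-! ### The satisfiability problem -/

/-- UNFO sentences over `σ`. -/
def UNFOSentence (σ : FirstOrder.Language.{0, 0}) : Type :=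
  {φ : FOFormula σ // φ.IsUNFO ∧ φ.freeVars = ∅}

/-- UNFO sentences over `σ` of negation depth `d`. -/
def UNFOSentenceOfDepth (σ : FirstOrder.Language.{0, 0}) (d : ℕ) : Type :=
  {φ : UNFOSentence σ // φ.1.negDepth = d}

/-- A class of `σ`-structures. -/
abbrev StructureClass (σ : FirstOrder.Language.{0, 0}) : Type 1 :=
  ∀ M : Type, σ.Structure M → Prop

/-- `φ` is true in some structure from the class `𝒦`, under some assignment (the assignment is
irrelevant for sentences; its existence says that the domain is nonempty). -/
def SatisfiableIn {σ : FirstOrder.Language.{0, 0}} (𝒦 : StructureClass σ) (φ : FOFormula σ) :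
    Prop :=
  ∃ (M : Type) (S : σ.Structure M), 𝒦 M S ∧ ∃ v : ℕ → M, φ.Realize v

/-- All structures (with nonempty domain). -/
def allStructures (σ : FirstOrder.Language.{0, 0}) : StructureClass σ :=
  fun M _ => Nonempty M

/-- All structures with a finite (nonempty) domain. -/
def finiteStructures (σ : FirstOrder.Language.{0, 0}) : StructureClass σ :=
  fun M _ => Nonempty M ∧ Finite M

/-! ### Finite trees -/

/-- The relation symbols for node-labelled trees: a binary relation `child` and `m` unary
relations. -/
inductive TreeRel (m : ℕ) : ℕ → Type
  | child : TreeRel m 2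
  | label (i : Fin m) : TreeRel m 1

/-- The relational signature of trees with `m` unary predicates. -/
def treeSig (m : ℕ) : FirstOrder.Language.{0, 0} :=
  ⟨fun _ => Empty, TreeRel m⟩

instance treeSig.instIsRelational (m : ℕ) : (treeSig m).IsRelational :=
  fun _ => inferInstanceAs (IsEmpty Empty)

/-- The signature is finite. -/
instance treeSig.instFinite (m : ℕ) : Finite (Σ n, (treeSig m).Relations n) := by
  let g : Option (Fin m) → Σ n, TreeRel m n
    | none => ⟨2, .child⟩
    | some i => ⟨1, .label i⟩
  refine Finite.of_surjective (β := Σ n, TreeRel m n) g ?_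
  rintro ⟨_, _ | i⟩
  · exact ⟨none, rfl⟩
  · exact ⟨some i, rfl⟩

/-- `y` is a child of `x`. -/
def IsChild {m : ℕ} {M : Type} (S : (treeSig m).Structure M) (x y : M) : Prop :=
  S.RelMap (TreeRel.child : (treeSig m).Relations 2) ![x, y]

/-- Finite trees: the `child` relation makes the finite domain a rooted tree, i.e. there is a root
without parent, every other node has exactly one parent, and every node can be reached from
the root. The unary predicates are arbitrary. -/
def finiteTrees (m : ℕ) : StructureClass (treeSig m) :=
  fun M S => Finite M ∧ ∃ r : M,
    (∀ x, ¬ IsChild S x r) ∧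
    (∀ y, y ≠ r → ∃! x, IsChild S x y) ∧
    ∀ y, Relation.ReflTransGen (IsChild S) r y

/-! ### Doubly exponential time and hardness -/

open Turing in
/-- The deterministic one-tape Turing machine `M` decides the language `L` over the alphabet `A` in
time `T`: on the input `w`, whose letters are written on the tape through `ι`, it halts after at
most `T |w|` steps, in a state from `acc` if and only if `w ∈ L`. -/
def DecidesInTime {A Γ Λ : Type} [Inhabited Γ] [Inhabited Λ] (M : TM0.Machine Γ Λ)
    (ι : A → Γ) (acc : Set Λ) (T : ℕ → ℕ) (L : Language A) : Prop :=
  ∀ w : List A, ∃ c : TM0.Cfg Γ Λ,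
    Nonempty (StateTransition.EvalsToInTime (TM0.step M) (TM0.init (w.map ι)) (some c)
      (T w.length)) ∧
    TM0.step M c = none ∧
    (w ∈ L ↔ c.q ∈ acc)

/-- The complexity class 2EXPTIME: languages decided by a deterministic Turing machine with
finitely many states and tape symbols in time `2 ^ 2 ^ p(n)` for some polynomial `p`. The input
letters are tape symbols different from the blank `default`. -/
def InTwoExpTime {A : Type} (L : Language A) : Prop :=
  ∃ (Γ Λ : Type) (_ : Fintype Γ) (_ : Fintype Λ) (_ : Inhabited Γ) (_ : Inhabited Λ)
    (M : Turing.TM0.Machine Γ Λ) (ι : A → Γ) (acc : Set Λ) (p : Polynomial ℕ),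
    Function.Injective ι ∧ (∀ a, ι a ≠ default) ∧
    DecidesInTime M ι acc (fun n => 2 ^ 2 ^ p.eval n) L

/-- The decision problem `P`, on instances from `α` written as strings over the finite alphabet `B`
through `enc`, is 2EXPTIME-hard: each language in 2EXPTIME, over any finite alphabet, is
many-one reducible to it by a function that a Turing machine computes in polynomial time. -/
def TwoExpTimeHard {α B : Type} [Finite B] (enc : α → List B) (P : Set α) : Prop :=
  ∀ (A : Type) [Finite A] (L : Language A), InTwoExpTime L →
    ∃ f : List A → α,
      Nonempty (Turing.TM2ComputableInPolyTime (fun w : List A => w) enc f) ∧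
      ∀ w : List A, w ∈ L ↔ f w ∈ P

/-- The satisfiability problem for UNFO over the class `𝒦` is 2EXPTIME-hard. -/
def UNFOSatHard {σ : FirstOrder.Language.{0, 0}} [Finite (Σ n, σ.Relations n)]
    (𝒦 : StructureClass σ) : Prop :=
  TwoExpTimeHard (fun φ : UNFOSentence σ => φ.1.encode) {φ | SatisfiableIn 𝒦 φ.1}

/-- The satisfiability problem over the class `𝒦`, restricted to UNFO sentences of negation
depth `d` as instances, is 2EXPTIME-hard. -/
def UNFOSatHardAtDepth {σ : FirstOrder.Language.{0, 0}} [Finite (Σ n, σ.Relations n)]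
    (d : ℕ) (𝒦 : StructureClass σ) : Prop :=
  TwoExpTimeHard (fun φ : UNFOSentenceOfDepth σ d => φ.1.1.encode)
    {φ | SatisfiableIn 𝒦 φ.1.1}

end UnaryNegation

/-! A run of a machine within time `2 ^ 2 ^ p(n)` is laid out on a quarter plane in which every
inner entry is a function of two neighbours (`InTwoExpTime.exists_grid`). That the entry with
coordinates `(u, v)` is accepting is then certified by unfolding the recursion: a node for `(u, v)`
has children for `(u - 1, v)` and `(u, v - 1)`, and so on down to the border. The sentence describes
such unfoldings.

The two coordinates are below `2 ^ 2 ^ k`. Each is stored as `2 ^ k` bits at the leaves of an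
address tree of depth `k` below the node, so that formulas of length linear in `k` can speak about
them. Unary negation cannot define when two nodes carry the same number. It can deny, by a negated
sentence, that there are two nodes and two leaves with the same address whose bits conflict; the
leaves are found by a simultaneous existential descent. To make "decremented by one" a condition on
single bits, the address tree of a child carries marks saying where the two numbers agree, where the
decrement happens and where it borrows. The marks are checked locally at each inner node. The
signature has to be fixed while the number of possible entries depends on the language, so entries
are written in unary on paths.

Soundness holds in every structure, with no tree property assumed: the counters of marked nodes are
well defined (`IsComputation.bit_iff`), children decrement them (`IsComputation.counterVal_child`),
and induction on the sum of the counters shows that the datum of a node is the grid entry at its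
coordinates (`IsComputation.data_eq_gridVal`). Conversely, an accepting entry gives a finite tree
satisfying the sentence (`IsUnfolding.isComputation`, `CompTree.finiteTrees`). Hence a single
reduction serves all classes that contain the finite trees.

The sentence is built by iterating two formula transformers, each of which adds a constant prefix to
the string, and by one block per input letter. Strings of this shape are printed by an explicit
stack machine in polynomial time (`nonempty_tm2ComputableInPolyTime_of_blocks`). -/

namespace UnaryNegation

/-! ### Grid automata -/

section Grid

variable {D : Type}

/-- The labelling of the quarter plane `ℕ × ℕ` in which row `0` is a given word followed by blanks,
column `0` is blank otherwise, and each other entry is computed from its two predecessors. -/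
def gridVal (F : D → D → D) (β : D) (word : List D) : ℕ → ℕ → D
  | 0, v => word.getD v β
  | _ + 1, 0 => β
  | u + 1, v + 1 => F (gridVal F β word u (v + 1)) (gridVal F β word (u + 1) v)

/-- This allows the entries to be renamed as elements of `Fin (d + 1)`, which is what makes it
possible to write them in unary. -/
theorem gridVal_equiv {E : Type} (e : D ≃ E) (F : D → D → D) (β : D) (word : List D) :
    ∀ u v, gridVal (fun a b => e (F (e.symm a) (e.symm b))) (e β) (word.map e) u v =
      e (gridVal F β word u v)
  | 0, v => by
    simp only [gridVal, List.getD_eq_getElem?_getD, List.getElem?_map]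
    cases word[v]? <;> rfl
  | _ + 1, 0 => by simp only [gridVal]
  | u + 1, v + 1 => by
    simp only [gridVal, gridVal_equiv e F β word u (v + 1), gridVal_equiv e F β word (u + 1) v,
      Equiv.symm_apply_apply]

end Grid

/-! ### Turing machines as cellular automata -/

section Cells

open Turing

variable {Γ Λ : Type}

/-- A tape cell: its symbol, and the state of the machine if the head is there. -/
abbrev Cell (Γ Λ : Type) : Type := Γ × Option Λ

/-- The local rule of the cellular automaton simulating a machine with transitions `δ`. -/
def cellRule (δ : Λ → Γ → Option (Λ × TM0.Stmt Γ)) (l c r : Cell Γ Λ) : Cell Γ Λ :=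
  match c.2 with
  | some q =>
    match δ q c.1 with
    | none => c
    | some (_, .move _) => (c.1, none)
    | some (q', .write a) => (a, some q')
  | none =>
    match l.2.bind fun q => δ q l.1 with
    | some (q', .move .right) => (c.1, some q')
    | _ =>
      match r.2.bind fun q => δ q r.1 with
      | some (q', .move .left) => (c.1, some q')
      | _ => c

/-- The cells of the tape `T` with the head at position `h` in state `q`. -/
def headCells (q : Λ) (h : ℤ) (T : ℤ → Γ) (p : ℤ) : Cell Γ Λ :=
  (T p, if p = h then some q else none)

variable (δ : Λ → Γ → Option (Λ × TM0.Stmt Γ))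

/-- One step of a machine on head state, head position and tape; a halted machine does not change. -/
def headStep (q : Λ) (h : ℤ) (T : ℤ → Γ) : Λ × ℤ × (ℤ → Γ) :=
  match δ q (T h) with
  | none => (q, h, T)
  | some (q', .move .left) => (q', h - 1, T)
  | some (q', .move .right) => (q', h + 1, T)
  | some (q', .write a) => (q', h, Function.update T h a)

theorem cellRule_headCells (q : Λ) (h : ℤ) (T : ℤ → Γ) (p : ℤ) :
    cellRule δ (headCells q h T (p - 1)) (headCells q h T p) (headCells q h T (p + 1)) =
      headCells (headStep δ q h T).1 (headStep δ q h T).2.1 (headStep δ q h T).2.2 p := by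
  rcases hδ : δ q (T h) with _ | ⟨q', (_ | _) | a⟩ <;>
    simp only [headStep, hδ] <;>
    rcases lt_trichotomy p h with hp | rfl | hp
  -- The three alternatives correspond to `p = h`, `p > h` and `p < h`. Away from the head, only a
  -- cell adjacent to it can change.
  all_goals first
    | (have h1 : p ≠ p - 1 := by omega
       simp [cellRule, headCells, hδ, h1]; done)
    | (have h1 : p + 1 ≠ h := by omega
       have h2 : p ≠ h := by omega
       by_cases h3 : p - 1 = h
       · have h4 : p ≠ h - 1 := by omega
         have h5 : p = h + 1 := by omega
         subst h3
         simp [cellRule, headCells, hδ, h1, h2, h4]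
       · have h4 : p ≠ h - 1 := by omega
         have h5 : p ≠ h + 1 := by omega
         simp [cellRule, headCells, h1, h2, h3, h4, h5])
    | (have h1 : p - 1 ≠ h := by omega
       have h2 : p ≠ h := by omega
       by_cases h3 : p + 1 = h
       · have h4 : p = h - 1 := by omega
         have h5 : p ≠ h + 1 := by omega
         subst h3
         simp [cellRule, headCells, hδ, h1, h5]
       · have h4 : p ≠ h - 1 := by omega
         have h5 : p ≠ h + 1 := by omega
         simp [cellRule, headCells, h1, h2, h3, h4, h5])

/-- The space-time diagram of the cellular automaton. -/
def cellRow (c₀ : ℤ → Cell Γ Λ) : ℕ → ℤ → Cell Γ Λ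
  | 0 => c₀
  | t + 1 => fun p => cellRule δ (cellRow c₀ t (p - 1)) (cellRow c₀ t p) (cellRow c₀ t (p + 1))

/-- Information travels at most one cell per step, so the blank half-line recedes at speed one. This
yields the blank column `0` of the grid. -/
theorem cellRow_blank (c₀ : ℤ → Cell Γ Λ) (b : Γ) (h₀ : ∀ p ≤ 0, c₀ p = (b, none)) :
    ∀ (t : ℕ) (p : ℤ), p ≤ -t → cellRow δ c₀ t p = (b, none)
  | 0, p, hp => h₀ p (by simpa using hp)
  | t + 1, p, hp => by
    push_cast at hp
    simp only [cellRow, cellRow_blank c₀ b h₀ t (p - 1) (by omega),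
      cellRow_blank c₀ b h₀ t p (by omega), cellRow_blank c₀ b h₀ t (p + 1) (by omega)]
    rfl

/-- The entry of the grid in row `t` and column `v`: cell `v - t` at time `t`, and cells `v - t` and
`v - t + 1` one step earlier. -/
def cellRowTriple (c₀ : ℤ → Cell Γ Λ) (b : Γ) : ℕ → ℕ → Cell Γ Λ × Cell Γ Λ × Cell Γ Λ
  | 0, v => (c₀ v, (b, none), (b, none))
  | t + 1, v => (cellRow δ c₀ (t + 1) (v - (t + 1)), cellRow δ c₀ t (v - (t + 1)),
      cellRow δ c₀ t (v - (t + 1) + 1))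

/-- The rule of the grid automaton simulating a cellular automaton. -/
def tripleRule (e₁ e₂ : Cell Γ Λ × Cell Γ Λ × Cell Γ Λ) : Cell Γ Λ × Cell Γ Λ × Cell Γ Λ :=
  (cellRule δ e₂.2.1 e₂.2.2 e₁.1, e₂.2.2, e₁.1)

theorem cellRowTriple_fst (c₀ : ℤ → Cell Γ Λ) (b : Γ) (t v : ℕ) :
    (cellRowTriple δ c₀ b t v).1 = cellRow δ c₀ t (v - t) := by
  cases t <;> simp [cellRowTriple, cellRow]

/-- A cell depends on three cells of the previous time. In the skewed coordinates `v = p + t` its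
right predecessor lies in the entry above, and the left and middle ones are remembered by the entry
to the left. Thus two predecessors in the grid suffice. -/
theorem gridVal_tripleRule (c₀ : ℤ → Cell Γ Λ) (b : Γ) (h₀ : ∀ p ≤ 0, c₀ p = (b, none))
    (cells : List (Cell Γ Λ)) (hc : ∀ v : ℕ, c₀ v = cells.getD v (b, none)) :
    ∀ t v : ℕ, gridVal (tripleRule δ) ((b, none), (b, none), (b, none))
      (cells.map fun c => (c, (b, none), (b, none))) t v = cellRowTriple δ c₀ b t v
  | 0, v => by
    simp only [gridVal, cellRowTriple, hc, List.getD_eq_getElem?_getD, List.getElem?_map]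
    cases cells[v]? <;> rfl
  | t + 1, 0 => by
    simp only [gridVal, cellRowTriple]
    rw [cellRow_blank δ c₀ b h₀ (t + 1) _ (by push_cast; omega),
      cellRow_blank δ c₀ b h₀ t _ (by push_cast; omega),
      cellRow_blank δ c₀ b h₀ t _ (by push_cast; omega)]
  | t + 1, v + 1 => by
    rw [gridVal, gridVal_tripleRule c₀ b h₀ cells hc t (v + 1),
      gridVal_tripleRule c₀ b h₀ cells hc (t + 1) v]
    simp only [tripleRule, cellRowTriple_fst]
    simp only [cellRowTriple, cellRow]
    push_cast
    refine Prod.ext ?_ (Prod.ext ?_ ?_)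
    · simp only
      congr 2 <;> ring
    · simp only
      congr 1; ring
    · simp only
      congr 1; ring

end Cells

/-! ### The initial row of the grid. -/

section StartCells

open Turing

variable {Γ Λ : Type} [Inhabited Γ]

/-- The initial cells on input `l`: the head is in the additional initial state, to the left of the
input. -/
def startCells (l : List Γ) (p : ℤ) : Cell Γ (Option Λ) :=
  headCells none 1 (fun p => (Tape.mk₁ l).nth (p - 2)) p

theorem tape_mk₁_nth_neg (l : List Γ) (i : ℤ) (hi : i < 0) : (Tape.mk₁ l).nth i = default := by
  obtain ⟨n, rfl⟩ := Int.eq_negSucc_of_lt_zero hi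
  change (ListBlank.mk []).nth n = default
  simp [ListBlank.nth_mk, List.getI_eq_getElem?_getD]

theorem startCells_blank (l : List Γ) (p : ℤ) (hp : p ≤ 0) :
    startCells (Λ := Λ) l p = (default, none) := by
  have h1 : p ≠ 1 := by omega
  simp [startCells, headCells, tape_mk₁_nth_neg l (p - 2) (by omega), h1]

/-- The additional initial state keeps the head off the first input letter. The row therefore is a
constant prefix of two cells followed by a letterwise image of the input, which is easy to print. -/
theorem startCells_eq_getD (l : List Γ) (v : ℕ) :
    startCells (Λ := Λ) l v = ((default, none) :: (default, some none) ::
      l.map fun a => (a, none)).getD v (default, none) := by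
  match v with
  | 0 => simpa using startCells_blank l 0 le_rfl
  | 1 =>
    simp only [startCells, headCells]
    rw [tape_mk₁_nth_neg l _ (by norm_num)]
    simp
  | v + 2 =>
    have h1 : ((v + 2 : ℕ) : ℤ) ≠ 1 := by push_cast; omega
    have h2 : ((v + 2 : ℕ) : ℤ) - 2 = v := by push_cast; ring
    simp only [startCells, headCells, h1, h2, if_false]
    have : (Tape.mk₁ l).nth (v : ℤ) = l.getI v := by
      rw [Tape.mk₁, Tape.mk₂, Tape.mk'_nth_nat, ListBlank.nth_mk]
    rw [this, List.getI_eq_getElem?_getD]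
    simp only [List.getD_eq_getElem?_getD, List.getElem?_cons_succ, List.getElem?_map]
    cases l[v]? <;> rfl

end StartCells

/-! ### Machine runs as rows of the cellular automaton. -/

section Machine

open Turing

variable {Γ Λ : Type} [Inhabited Γ] [Inhabited Λ] (M : TM0.Machine Γ Λ)

/-- The transitions of `M`, with an additional initial state `none` that moves to the right and
enters the initial state of `M`. -/
def startDelta : Option Λ → Γ → Option (Option Λ × TM0.Stmt Γ)
  | none, _ => some (some default, .move .right)
  | some q, a => (M q a).map fun x => (some x.1, x.2)

/-- A step of `M` that leaves halting configurations unchanged. -/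
def stepOrStay (c : TM0.Cfg Γ Λ) : TM0.Cfg Γ Λ :=
  (TM0.step M c).getD c

/-- The cells of a configuration with the head at position `h`. -/
def cfgCells (c : TM0.Cfg Γ Λ) (h : ℤ) : ℤ → Cell Γ (Option Λ) :=
  headCells (some c.q) h fun p => c.Tape.nth (p - h)

/-- The tape of a configuration is indexed relative to the head, the cells are indexed absolutely; a
move of the head shifts one against the other. -/
theorem cellRule_cfgCells (c : TM0.Cfg Γ Λ) (h : ℤ) :
    ∃ h' : ℤ, |h' - h| ≤ 1 ∧ ∀ p,
      cellRule (startDelta M) (cfgCells c h (p - 1)) (cfgCells c h p) (cfgCells c h (p + 1)) =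
        cfgCells (stepOrStay M c) h' p := by
  obtain ⟨q, T⟩ := c
  have key := cellRule_headCells (startDelta M) (some q) h fun p => T.nth (p - h)
  have e0 : T.nth (h - h) = T.head := by rw [sub_self]; rfl
  simp only [headStep, e0] at key
  rcases hM : M q T.head with _ | ⟨q', (_ | _) | a⟩
  · refine ⟨h, by simp, fun p => (key p).trans ?_⟩
    simp [startDelta, cfgCells, stepOrStay, TM0.step, hM]
  · refine ⟨h - 1, by simp, fun p => (key p).trans ?_⟩
    simp only [startDelta, cfgCells, stepOrStay, TM0.step, hM, Option.map, Option.getD,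
      Tape.move_left_nth]
    congr 1
    funext p
    congr 1; ring
  · refine ⟨h + 1, by simp, fun p => (key p).trans ?_⟩
    simp only [startDelta, cfgCells, stepOrStay, TM0.step, hM, Option.map, Option.getD,
      Tape.move_right_nth]
    congr 1
    funext p
    congr 1; ring
  · refine ⟨h, by simp, fun p => (key p).trans ?_⟩
    simp only [startDelta, cfgCells, stepOrStay, TM0.step, hM, Option.map, Option.getD,
      Tape.write_nth]
    congr 1
    funext p
    by_cases hp : p = h
    · simp [hp]
    · simp [hp, sub_eq_zero]

/-- Row `n + 1` shows the machine after `n` steps, because one step is spent leaving the additional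
initial state. That step puts the head on cell `2`, the place of the first input letter. -/
theorem cellRow_startCells (l : List Γ) (n : ℕ) :
    ∃ h : ℤ, |h - 2| ≤ n ∧
      cellRow (startDelta M) (startCells l) (n + 1) =
        cfgCells ((stepOrStay M)^[n] (TM0.init l)) h := by
  induction n with
  | zero =>
    refine ⟨2, by simp, funext fun p => ?_⟩
    exact cellRule_headCells (startDelta M) none 1 _ p
  | succ n ih =>
    obtain ⟨h, hh, ih⟩ := ih
    obtain ⟨h', hh', key⟩ := cellRule_cfgCells M ((stepOrStay M)^[n] (TM0.init l)) h
    refine ⟨h', ?_, funext fun p => ?_⟩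
    · push_cast
      have := abs_add_le (h' - h) (h - 2)
      rw [sub_add_sub_cancel] at this
      linarith
    · rw [cellRow, ih, Function.iterate_succ_apply', ← key]

theorem iterate_stepOrStay_of_evals {n : ℕ} {c c' : TM0.Cfg Γ Λ}
    (h : (flip bind (TM0.step M))^[n] (some c) = some c') : (stepOrStay M)^[n] c = c' := by
  induction n generalizing c with
  | zero => simpa using h
  | succ n ih =>
    rw [Function.iterate_succ_apply] at h ⊢
    change (flip bind (TM0.step M))^[n] (TM0.step M c) = _ at h
    rw [stepOrStay]
    cases hc : TM0.step M c with
    | some d => exact ih (hc ▸ h)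
    | none =>
      exfalso
      rw [hc, Function.iterate_fixed (show flip bind (TM0.step M) none = none from rfl)] at h
      cases h

theorem iterate_stepOrStay_of_halted {m n : ℕ} {c : TM0.Cfg Γ Λ}
    (h : TM0.step M ((stepOrStay M)^[m] c) = none) (hmn : m ≤ n) :
    (stepOrStay M)^[n] c = (stepOrStay M)^[m] c := by
  obtain ⟨r, rfl⟩ := Nat.exists_eq_add_of_le' hmn
  rw [Function.iterate_add_apply]
  apply Function.iterate_fixed
  rw [stepOrStay, h]
  rfl

/-- An accepting entry may occur in any row; uniqueness of the halting configuration identifies it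
with the one that decides membership. -/
theorem iterate_stepOrStay_halted_unique {m n : ℕ} {c : TM0.Cfg Γ Λ}
    (hm : TM0.step M ((stepOrStay M)^[m] c) = none)
    (hn : TM0.step M ((stepOrStay M)^[n] c) = none) :
    (stepOrStay M)^[m] c = (stepOrStay M)^[n] c := by
  rcases le_total m n with h | h
  · exact (iterate_stepOrStay_of_halted M hm h).symm
  · exact iterate_stepOrStay_of_halted M hn h

theorem step_eq_none_iff (c : TM0.Cfg Γ Λ) : TM0.step M c = none ↔ M c.q c.Tape.head = none := by
  obtain ⟨q, T⟩ := c
  simp [TM0.step]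

end Machine

/-- Each language in 2EXPTIME is recognized by a grid automaton on a doubly exponential grid. -/
theorem InTwoExpTime.exists_grid {A : Type} {L : Language A} (h : InTwoExpTime L) :
    ∃ (d : ℕ) (F : Fin (d + 1) → Fin (d + 1) → Fin (d + 1)) (β : Fin (d + 1))
      (pre : List (Fin (d + 1))) (letter : A → Fin (d + 1)) (acc : Set (Fin (d + 1)))
      (p : Polynomial ℕ), ∀ w : List A,
      (∀ u v, gridVal F β (pre ++ w.map letter) u v ∈ acc → w ∈ L) ∧
      (w ∈ L → ∃ u v, u < 2 ^ 2 ^ p.eval w.length ∧ v < 2 ^ 2 ^ p.eval w.length ∧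
        gridVal F β (pre ++ w.map letter) u v ∈ acc) := by
  obtain ⟨Γ, Λ, _, _, _, _, M, ι, acc, p, -, -, hM⟩ := h
  let b : Cell Γ (Option Λ) := (default, none)
  let D := Cell Γ (Option Λ) × Cell Γ (Option Λ) × Cell Γ (Option Λ)
  let inj : Cell Γ (Option Λ) → D := fun c => (c, b, b)
  have : Nonempty D := ⟨inj b⟩
  obtain ⟨d, hd⟩ : ∃ d, Nat.card D = d + 1 :=
    ⟨Nat.card D - 1, (Nat.succ_pred_eq_of_pos Nat.card_pos).symm⟩
  let e : D ≃ Fin (d + 1) := hd ▸ Finite.equivFin D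
  let accD : Set D := {x | ∃ q ∈ acc, x.1.2 = some (some q) ∧ M q x.1.1 = none}
  refine ⟨d, fun a b => e (tripleRule (startDelta M) (e.symm a) (e.symm b)), e (inj b),
    [e (inj b), e (inj (default, some none))],
    -- Adding `2` to the exponent leaves room for columns: a column index is position plus time,
    -- hence at most about twice the running time.
    fun a => e (inj (ι a, none)), e.symm ⁻¹' accD, p + 2, fun w => ?_⟩
  have hval : ∀ u v, e.symm (gridVal (fun a b => e (tripleRule (startDelta M) (e.symm a) (e.symm b)))
      (e (inj b)) ([e (inj b), e (inj (default, some none))] ++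
        w.map fun a => e (inj (ι a, none))) u v) =
      cellRowTriple (startDelta M) (startCells (w.map ι)) default u v := by
    intro u v
    have h1 : [e (inj b), e (inj (default, some none))] ++ (w.map fun a => e (inj (ι a, none))) =
        (((b :: (default, some none) :: (w.map ι).map fun a => (a, none))).map inj).map e := by
      simp [Function.comp_def]
    rw [h1, gridVal_equiv e, Equiv.symm_apply_apply]
    exact gridVal_tripleRule _ _ _ (startCells_blank _) _ (startCells_eq_getD _) u v
  have hmem : ∀ u v, gridVal (fun a b => e (tripleRule (startDelta M) (e.symm a) (e.symm b)))
      (e (inj b)) ([e (inj b), e (inj (default, some none))] ++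
        w.map fun a => e (inj (ι a, none))) u v ∈ e.symm ⁻¹' accD ↔
      ∃ q ∈ acc, (cellRow (startDelta M) (startCells (w.map ι)) u (v - u)).2 = some (some q) ∧
        M q (cellRow (startDelta M) (startCells (w.map ι)) u (v - u)).1 = none := by
    intro u v
    rw [Set.mem_preimage, hval, ← cellRowTriple_fst]
    rfl
  obtain ⟨c, ⟨⟨⟨steps, hsteps⟩, hle⟩⟩, hhalt, hacc⟩ := hM w
  have hrun := iterate_stepOrStay_of_evals M hsteps
  refine ⟨fun u v huv => ?_, fun hw => ?_⟩
  · rw [hmem] at huv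
    obtain ⟨q, hq, h1, h2⟩ := huv
    cases u with
    -- In row `0` the head is in the additional state, which is not accepting.
    | zero =>
      simp only [cellRow, startCells, headCells] at h1
      split_ifs at h1
      cases h1
    | succ u =>
      obtain ⟨h, -, hrow⟩ := cellRow_startCells M (w.map ι) u
      rw [hrow] at h1 h2
      simp only [cfgCells, headCells] at h1 h2
      split_ifs at h1 with hp
      simp only [Option.some.injEq] at h1
      rw [hp, sub_self, ← h1] at h2
      have hnone := (step_eq_none_iff M _).2 h2
      rw [hacc, ← hrun]
      rw [← h1] at hq
      rwa [← iterate_stepOrStay_halted_unique M hnone (by rw [hrun]; exact hhalt)]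
  · obtain ⟨h, hh, hrow⟩ := cellRow_startCells M (w.map ι) steps
    rw [hrun] at hrow
    have hbound : 2 * 2 ^ 2 ^ p.eval w.length + 4 ≤ 2 ^ 2 ^ (p + 2).eval w.length := by
      have e1 : (p + 2).eval w.length = p.eval w.length + 2 := by simp
      rw [e1, pow_add 2 _ 2, pow_mul]
      have h2 : 2 ≤ 2 ^ 2 ^ p.eval w.length := by
        calc 2 = 2 ^ 1 := rfl
          _ ≤ _ := Nat.pow_le_pow_right (by norm_num) Nat.one_le_two_pow
      generalize 2 ^ 2 ^ p.eval w.length = x at h2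
      have h3 : 2 * x ≤ x * x := Nat.mul_le_mul_right x h2
      calc 2 * x + 4 ≤ 4 * (x * x) := by omega
        _ ≤ x * x * (x * x) := Nat.mul_le_mul_right _ (by omega)
        _ = x ^ 2 ^ 2 := by ring
    have hsteps' : steps ≤ 2 ^ 2 ^ p.eval w.length := by simpa using hle
    have hv : (((h + (steps + 1 : ℕ)).toNat : ℕ) : ℤ) = h + (steps + 1 : ℕ) := by
      apply Int.toNat_of_nonneg
      have := (abs_le.1 hh).1
      push_cast
      linarith
    refine ⟨steps + 1, (h + (steps + 1 : ℕ)).toNat, by omega, ?_, ?_⟩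
    · have := (abs_le.1 hh).2
      generalize 2 ^ 2 ^ p.eval w.length = x at hbound hsteps'
      generalize 2 ^ 2 ^ (p + 2).eval w.length = y at hbound ⊢
      omega
    · rw [hmem, hv, hrow]
      refine ⟨c.q, hacc.1 hw, ?_, ?_⟩
      · simp [cfgCells, headCells]
      · simp only [cfgCells, headCells, add_sub_cancel_right, sub_self]
        exact (step_eq_none_iff M c).1 hhalt

/-! ### Labelled graphs describing computations of grid automata -/

/-- Marks on the nodes of the address tree of a child: the counter that is decremented has the same
bits as that of the parent below this node, or is decremented there, or borrows there. -/
inductive Mark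
  | same | dec | bor

/-- The node labels. The two counters are named by Booleans. -/
inductive Lab
  | cfg
  | addr (b : Bool)
  | bit (c b : Bool)
  | mark (m : Mark)
  | child (c : Bool)
  | zero (c : Bool)
  | path
  | last

instance Mark.instFinite : Finite Mark := by
  refine Finite.of_injective (β := Fin 3) (fun
    | .same => 0
    | .dec => 1
    | .bor => 2) fun m m' => ?_
  cases m <;> cases m' <;> simp

instance Lab.instFinite : Finite Lab := by
  refine Finite.of_injective (β := Fin 8 × Option Mark × Bool × Bool) (fun
    | .cfg => (0, none, false, false)
    | .addr b => (1, none, b, false)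
    | .bit c b => (2, none, c, b)
    | .mark m => (3, some m, false, false)
    | .child c => (4, none, c, false)
    | .zero c => (5, none, c, false)
    | .path => (6, none, false, false)
    | .last => (7, none, false, false)) fun l l' => ?_
  cases l <;> cases l' <;> simp

section Semantics

variable {M : Type} (R : M → M → Prop) (ℓ : Lab → M → Prop)

/-- The node carries the datum `e`, written in unary on a path. -/
def DataAt : ℕ → M → Prop
  | 0, x => ℓ .last x
  | e + 1, x => ∃ y, R x y ∧ ℓ .path y ∧ DataAt e y

/-- The node `y` has the address `a` in the address tree of `x`. -/
def AddrWalk : List Bool → M → M → Prop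
  | [], x, y => x = y
  | b :: a, x, y => ∃ z, R x z ∧ ℓ (.addr b) z ∧ AddrWalk a z y

/-- There is a child in the address tree on side `b` with mark `m`. -/
def HasSide (b : Bool) (m : Mark) (x : M) : Prop :=
  ∃ y, R x y ∧ ℓ (.addr b) y ∧ ℓ (.mark m) y

/-- The children in the address tree carry marks as required by the mark of the parent. -/
def MarkOK : Mark → M → Prop
  | .same, x => HasSide R ℓ false .same x ∧ HasSide R ℓ true .same x
  | .bor, x => HasSide R ℓ false .bor x ∧ HasSide R ℓ true .bor x
  | .dec, x => (HasSide R ℓ false .dec x ∧ HasSide R ℓ true .same x) ∨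
      (HasSide R ℓ false .bor x ∧ HasSide R ℓ true .dec x)

/-- Both counters have a bit at this leaf. -/
def LeafOK (x : M) : Prop :=
  (ℓ (.bit false false) x ∨ ℓ (.bit false true) x) ∧ (ℓ (.bit true false) x ∨ ℓ (.bit true true) x)

/-- The address tree below `x` is complete down to depth `k`. -/
def TreeOK : ℕ → M → Prop
  | 0, x => LeafOK ℓ x
  | k + 1, x => (∀ m, ℓ (.mark m) x → MarkOK R ℓ m x) ∧
      ∀ y, R x y → ℓ (.addr false) y ∨ ℓ (.addr true) y → TreeOK k y

/-- The bits of counter `c` at two leaves differ. -/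
def SameBad (c : Bool) (z z' : M) : Prop :=
  (ℓ (.bit c false) z ∧ ℓ (.bit c true) z') ∨ (ℓ (.bit c true) z ∧ ℓ (.bit c false) z')

/-- The bits of counter `c` at two leaves contradict the mark at the second one. -/
def DecBad (c : Bool) (z z' : M) : Prop :=
  (ℓ (.mark .same) z' ∧ SameBad ℓ c z z') ∨
  (ℓ (.mark .dec) z' ∧ (ℓ (.bit c false) z ∨ ℓ (.bit c true) z')) ∨
  (ℓ (.mark .bor) z' ∧ (ℓ (.bit c true) z ∨ ℓ (.bit c false) z'))

/-- The leaves `z` of `x` and `z'` of `y` with the same address contradict the relation between the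
counters of `x` and `y`. -/
def CounterBad (x y z z' : M) : Prop :=
  (x = y ∧ ∃ c, (ℓ (.bit c false) z ∧ ℓ (.bit c true) z') ∨ (ℓ (.zero c) x ∧ ℓ (.bit c true) z)) ∨
  (R x y ∧ ∃ c, ℓ (.child c) y ∧ (DecBad ℓ c z z' ∨ SameBad ℓ (!c) z z'))

/-- There is a child for counter `c`. -/
def HasChild (c : Bool) (P : M → Prop) (x : M) : Prop :=
  ∃ y, R x y ∧ ℓ .cfg y ∧ ℓ (.child c) y ∧ P y

variable {d : ℕ}

/-- The node carries a datum different from `e`. -/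
def DataNe (e : Fin (d + 1)) (x : M) : Prop :=
  ∃ e' : Fin (d + 1), e' ≠ e ∧ DataAt R ℓ e' x

/-- The datum of `x` contradicts the word read along the second counter from `y`. -/
def WordBad (β : Fin (d + 1)) : List (Fin (d + 1)) → M → M → Prop
  | [], x, _ => DataNe R ℓ β x
  | e :: word, x, y => (ℓ (.zero true) y ∧ DataNe R ℓ e x) ∨
      HasChild R ℓ true (fun z => WordBad β word x z) y

/-- The data of `x` and its children contradict the rule of the grid automaton. -/
def RuleBad (F : Fin (d + 1) → Fin (d + 1) → Fin (d + 1)) (x : M) : Prop :=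
  ∃ e e₁ e₂ : Fin (d + 1), e ≠ F e₁ e₂ ∧ DataAt R ℓ e x ∧
    HasChild R ℓ false (DataAt R ℓ e₁) x ∧ HasChild R ℓ true (DataAt R ℓ e₂) x

/-- The datum of `x` contradicts the boundary condition of the grid automaton. -/
def BorderBad (β : Fin (d + 1)) (x : M) : Prop :=
  ℓ (.zero true) x ∧ HasChild R ℓ false (fun _ => True) x ∧ DataNe R ℓ β x

/-- The labelled graph describes an accepting computation of a grid automaton. -/
structure IsComputation (k : ℕ) (F : Fin (d + 1) → Fin (d + 1) → Fin (d + 1)) (β : Fin (d + 1))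
    (word : List (Fin (d + 1))) (acc : Set (Fin (d + 1))) : Prop where
  root : ∃ x, ℓ .cfg x ∧ ℓ (.mark .same) x ∧ ∃ e ∈ acc, DataAt R ℓ e x
  data : ∀ x, ℓ .cfg x → ∃ e : Fin (d + 1), DataAt R ℓ e x
  child : ∀ x, ℓ .cfg x → ∀ c, ℓ (.zero c) x ∨ HasChild R ℓ c (ℓ (.mark .dec)) x
  rule : ∀ x, ℓ .cfg x → ¬ RuleBad R ℓ F x
  border : ∀ x, ℓ .cfg x → ¬ BorderBad R ℓ β x
  counter : ∀ x y, ℓ .cfg x → ℓ .cfg y → ∀ a : List Bool, a.length = k → ∀ z z',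
    AddrWalk R ℓ a x z → AddrWalk R ℓ a y z' → ¬ CounterBad R ℓ x y z z'
  tree : ∀ x, ℓ .cfg x → TreeOK R ℓ k x
  word : ∀ x, ℓ .cfg x → ℓ (.zero false) x → ¬ WordBad R ℓ β word x x

end Semantics

/-! ### Numbers given by bits at addresses -/

open Classical in
/-- The number below `2 ^ 2 ^ k` whose bits are given at the addresses of length `k`. -/
noncomputable def addrVal : ℕ → (List Bool → Prop) → ℕ
  | 0, f => if f [] then 1 else 0
  | k + 1, f => addrVal k (fun a => f (false :: a)) + 2 ^ 2 ^ k * addrVal k (fun a => f (true :: a))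

theorem addrVal_congr {k : ℕ} {f g : List Bool → Prop}
    (h : ∀ a : List Bool, a.length = k → (f a ↔ g a)) : addrVal k f = addrVal k g := by
  induction k generalizing f g with
  | zero => by_cases hg : g [] <;> simp [addrVal, hg, h [] rfl]
  | succ k ih =>
    simp only [addrVal]
    rw [ih fun a ha => h (false :: a) (by simp [ha]), ih fun a ha => h (true :: a) (by simp [ha])]

theorem addrVal_eq_zero {k : ℕ} {f : List Bool → Prop}
    (h : ∀ a : List Bool, a.length = k → ¬ f a) : addrVal k f = 0 := by
  induction k generalizing f with
  | zero => simp [addrVal, h [] rfl]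
  | succ k ih =>
    simp only [addrVal]
    rw [ih fun a ha => h (false :: a) (by simp [ha]), ih fun a ha => h (true :: a) (by simp [ha])]
    simp

theorem two_pow_two_pow_succ (k : ℕ) : 2 ^ 2 ^ (k + 1) = 2 ^ 2 ^ k * 2 ^ 2 ^ k := by
  rw [pow_succ 2 k, pow_mul, sq]

/-! ### Every model of the conditions computes the grid. -/

section Soundness

variable {M : Type} {R : M → M → Prop} {ℓ : Lab → M → Prop}

theorem MarkOK.exists_side {m : Mark} {x : M} (h : MarkOK R ℓ m x) (b : Bool) :
    ∃ m', HasSide R ℓ b m' x := by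
  cases m with
  | same => cases b <;> exact ⟨.same, by first | exact h.1 | exact h.2⟩
  | bor => cases b <;> exact ⟨.bor, by first | exact h.1 | exact h.2⟩
  | dec =>
    rcases h with h | h
    · cases b
      · exact ⟨_, h.1⟩
      · exact ⟨_, h.2⟩
    · cases b
      · exact ⟨_, h.1⟩
      · exact ⟨_, h.2⟩

theorem TreeOK.side {k : ℕ} {b : Bool} {m : Mark} {x : M} (h : TreeOK R ℓ (k + 1) x)
    (hs : HasSide R ℓ b m x) :
    ∃ y, R x y ∧ ℓ (.addr b) y ∧ ℓ (.mark m) y ∧ TreeOK R ℓ k y := by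
  obtain ⟨y, h1, h2, h3⟩ := hs
  exact ⟨y, h1, h2, h3, h.2 y h1 (by cases b <;> simp [h2])⟩

/-- Existence of address-tree nodes comes only from marks: a marked node has a marked child on each
side, so a mark at the top makes every address occur. -/
theorem TreeOK.exists_leaf {a : List Bool} {x : M} (h : TreeOK R ℓ a.length x) {m : Mark}
    (hm : ℓ (.mark m) x) : ∃ z, AddrWalk R ℓ a x z ∧ LeafOK ℓ z := by
  induction a generalizing x m with
  | nil => exact ⟨x, rfl, h⟩
  | cons b a ih =>
    obtain ⟨m', hs⟩ := (h.1 m hm).exists_side b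
    obtain ⟨y, h1, h2, h3, h4⟩ := h.side hs
    obtain ⟨z, hz, hz'⟩ := ih h4 h3
    exact ⟨z, ⟨y, h1, h2, hz⟩, hz'⟩

theorem TreeOK.leafOK {a : List Bool} {x z : M} (h : TreeOK R ℓ a.length x)
    (hz : AddrWalk R ℓ a x z) : LeafOK ℓ z := by
  induction a generalizing x with
  | nil => cases hz; exact h
  | cons b a ih =>
    obtain ⟨y, h1, h2, h3⟩ := hz
    exact ih (h.2 y h1 (by cases b <;> simp [h2])) h3

/-- The bits of two counters, of which the second is marked as the predecessor of the first. -/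
def MarkRel (m : Mark) (p q : Prop) : Prop :=
  match m with
  | .same => p ↔ q
  | .dec => p ∧ ¬ q
  | .bor => ¬ p ∧ q

/-- The values of two counters, of which the second is marked as the predecessor of the first. -/
def MarkVal (k : ℕ) (m : Mark) (p q : ℕ) : Prop :=
  match m with
  | .same => p = q
  | .dec => p = q + 1
  | .bor => p = 0 ∧ q + 1 = 2 ^ 2 ^ k

/-- This is subtraction of `1` by halves, with side `false` as the lower half. Either the lower half
is decremented and the upper one is unchanged, or the lower half passes from all zeros to all ones
and the upper one is decremented. The local conditions `MarkOK` enforce exactly these alternatives.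
-/
theorem TreeOK.addrVal_markRel {k : ℕ} {x : M} (h : TreeOK R ℓ k x) {m : Mark}
    (hm : ℓ (.mark m) x) {f g : List Bool → Prop}
    (hfg : ∀ a : List Bool, a.length = k → ∀ z, AddrWalk R ℓ a x z → ∀ m, ℓ (.mark m) z →
      MarkRel m (f a) (g a)) :
    MarkVal k m (addrVal k f) (addrVal k g) := by
  induction k generalizing x m f g with
  | zero =>
    have := hfg [] rfl x rfl m hm
    cases m with
    | same =>
      exact addrVal_congr fun a ha => by rw [List.length_eq_zero_iff.1 ha]; exact this
    | dec => simp [addrVal, this.1, this.2, MarkVal]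
    | bor => simp [addrVal, this.1, this.2, MarkVal]
  | succ k ih =>
    -- Several children may lie on the same side; any one with the required mark will do, since `f`
    -- and `g` depend only on addresses.
    have key : ∀ {b : Bool} {m : Mark}, HasSide R ℓ b m x → MarkVal k m
        (addrVal k fun a => f (b :: a)) (addrVal k fun a => g (b :: a)) := fun {b m} hs =>
      let hy := (h.side hs).choose_spec
      ih hy.2.2.2 hy.2.2.1 (f := fun a => f (b :: a)) (g := fun a => g (b :: a))
        fun a ha z hz => hfg (b :: a) (by simp [ha]) z ⟨_, hy.1, hy.2.1, hz⟩
    have hmk := h.1 m hm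
    have hpos : 0 < 2 ^ 2 ^ k := by positivity
    cases m with
    | same =>
      have h1 := key hmk.1
      have h2 := key hmk.2
      simp only [MarkVal] at h1 h2
      simp only [MarkVal, addrVal, h1, h2]
    | dec =>
      rcases hmk with hmk | hmk
      · have h1 := key hmk.1
        have h2 := key hmk.2
        simp only [MarkVal] at h1 h2
        simp only [MarkVal, addrVal, h1, h2]
        ring
      · have h1 := key hmk.1
        have h2 := key hmk.2
        simp only [MarkVal] at h1 h2
        simp only [MarkVal, addrVal, h1.1, h2, ← h1.2]
        ring
    | bor =>
      have h1 := key hmk.1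
      have h2 := key hmk.2
      simp only [MarkVal] at h1 h2
      simp only [MarkVal, addrVal, h1.1, h2.1, two_pow_two_pow_succ, ← h1.2]
      have h3 := h1.2.trans h2.2.symm
      refine ⟨by simp, ?_⟩
      rw [Nat.add_right_cancel h3]
      ring

/-- The bit of counter `c` of the node `x` at the address `a` is set. -/
def BitSet (R : M → M → Prop) (ℓ : Lab → M → Prop) (c : Bool) (x : M) (a : List Bool) : Prop :=
  ∃ z, AddrWalk R ℓ a x z ∧ ℓ (.bit c true) z

/-- The value of counter `c` of the node `x`. -/
noncomputable def counterVal (R : M → M → Prop) (ℓ : Lab → M → Prop) (k : ℕ) (c : Bool) (x : M) :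
    ℕ :=
  addrVal k (BitSet R ℓ c x)

namespace IsComputation

variable {d k : ℕ} {F : Fin (d + 1) → Fin (d + 1) → Fin (d + 1)} {β : Fin (d + 1)}
  {word : List (Fin (d + 1))} {acc : Set (Fin (d + 1))}

/-- In an arbitrary graph several leaves can share an address. The clause `x = y` of `CounterBad`
forbids them to carry opposite bits, and `LeafOK` gives each of them a bit. -/
theorem bit_iff (h : IsComputation R ℓ k F β word acc) {x z : M} (hx : ℓ .cfg x) (c : Bool)
    {a : List Bool} (ha : a.length = k) (hz : AddrWalk R ℓ a x z) :
    (ℓ (.bit c true) z ↔ BitSet R ℓ c x a) ∧ (ℓ (.bit c false) z ↔ ¬ BitSet R ℓ c x a) := by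
  subst ha
  have hleaf : ℓ (.bit c false) z ∨ ℓ (.bit c true) z := by
    have := (h.tree x hx).leafOK hz
    cases c
    · exact this.1
    · exact this.2
  have hcon : ∀ z', AddrWalk R ℓ a x z' → ℓ (.bit c false) z → ¬ ℓ (.bit c true) z' :=
    fun z' hz' h1 h2 => h.counter x x hx hx a rfl z z' hz hz' (.inl ⟨rfl, c, .inl ⟨h1, h2⟩⟩)
  have hno : ℓ (.bit c false) z → ¬ BitSet R ℓ c x a := fun h1 ⟨z', hz', h2⟩ => hcon z' hz' h1 h2
  have hyes : ℓ (.bit c true) z → BitSet R ℓ c x a := fun h1 => ⟨z, hz, h1⟩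
  exact ⟨⟨hyes, fun h1 => hleaf.resolve_left fun h2 => hno h2 h1⟩,
    ⟨hno, fun h1 => hleaf.resolve_right fun h2 => h1 (hyes h2)⟩⟩

theorem counterVal_of_zero (h : IsComputation R ℓ k F β word acc) {x : M} (hx : ℓ .cfg x)
    {c : Bool} (hc : ℓ (.zero c) x) : counterVal R ℓ k c x = 0 :=
  addrVal_eq_zero fun a ha ⟨z, hz, hb⟩ =>
    h.counter x x hx hx a ha z z hz hz (.inl ⟨rfl, c, .inr ⟨hc, hb⟩⟩)

/-- Absence of conflicts between leaves with equal addresses turns the marks of `y` into true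
relations between the bits of `x` and `y`. The mark of `x` serves only to provide its leaves. -/
theorem counterVal_child (h : IsComputation R ℓ k F β word acc) {x y : M} (hx : ℓ .cfg x)
    {m : Mark} (hm : ℓ (.mark m) x) (hxy : R x y) (hy : ℓ .cfg y) {c : Bool}
    (hc : ℓ (.child c) y) (hd : ℓ (.mark .dec) y) :
    counterVal R ℓ k c x = counterVal R ℓ k c y + 1 ∧
      counterVal R ℓ k (!c) x = counterVal R ℓ k (!c) y := by
  have hbad : ∀ a : List Bool, a.length = k → ∀ z z', AddrWalk R ℓ a x z → AddrWalk R ℓ a y z' →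
      ¬ DecBad ℓ c z z' ∧ ¬ SameBad ℓ (!c) z z' := fun a ha z z' hz hz' =>
    ⟨fun hb => h.counter x y hx hy a ha z z' hz hz' (.inr ⟨hxy, c, hc, .inl hb⟩),
      fun hb => h.counter x y hx hy a ha z z' hz hz' (.inr ⟨hxy, c, hc, .inr hb⟩)⟩
  constructor
  · refine (h.tree y hy).addrVal_markRel hd (f := BitSet R ℓ c x) (g := BitSet R ℓ c y)
      fun a ha z' hz' m' hm' => ?_
    obtain ⟨z, hz, -⟩ := TreeOK.exists_leaf (a := a) (ha ▸ h.tree x hx) hm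
    have hb := (hbad a ha z z' hz hz').1
    obtain ⟨h1, h2⟩ := h.bit_iff hx c ha hz
    obtain ⟨h3, h4⟩ := h.bit_iff hy c ha hz'
    simp only [DecBad, SameBad, h1, h2, h3, h4] at hb
    cases m' <;> simp only [hm', MarkRel] at hb ⊢ <;> tauto
  · refine addrVal_congr fun a ha => ?_
    obtain ⟨z, hz, -⟩ := TreeOK.exists_leaf (a := a) (ha ▸ h.tree x hx) hm
    obtain ⟨z', hz', -⟩ := TreeOK.exists_leaf (a := a) (ha ▸ h.tree y hy) hd
    have hb := (hbad a ha z z' hz hz').2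
    obtain ⟨h1, h2⟩ := h.bit_iff hx (!c) ha hz
    obtain ⟨h3, h4⟩ := h.bit_iff hy (!c) ha hz'
    simp only [SameBad, h1, h2, h3, h4] at hb
    tauto

/-- The node `x` stays fixed while `y` moves along children for the second counter. Each move drops
one letter and decrements the counter, so the letter met at zero is the one with the index that `y`
had at the beginning. -/
theorem eq_getD (h : IsComputation R ℓ k F β word acc) {x : M} {e : Fin (d + 1)}
    (he : DataAt R ℓ e x) {y : M} (hy : ℓ .cfg y) {m : Mark} (hm : ℓ (.mark m) y)
    {l : List (Fin (d + 1))} (hl : ¬ WordBad R ℓ β l x y) :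
    e = l.getD (counterVal R ℓ k true y) β := by
  induction l generalizing y m with
  | nil => exact by_contra fun hne => hl ⟨e, hne, he⟩
  | cons e' l ih =>
    rcases h.child y hy true with hz | ⟨z, hyz, hz, hc, hd⟩
    · rw [h.counterVal_of_zero hy hz]
      exact by_contra fun hne => hl (.inl ⟨hz, e, hne, he⟩)
    · rw [(h.counterVal_child hy hm hyz hz hc hd).1]
      exact ih hz hd fun hb => hl (.inr ⟨z, hyz, hz, hc, hb⟩)

/-- Induction on the sum of the counters, which every child lowers by one. The three cases of
`gridVal` are enforced by `word`, `border` and `rule`. Uniqueness of the datum is a consequence, not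
an assumption. -/
theorem data_eq_gridVal (h : IsComputation R ℓ k F β word acc) {x : M} (hx : ℓ .cfg x) {m : Mark}
    (hm : ℓ (.mark m) x) {e : Fin (d + 1)} (he : DataAt R ℓ e x) :
    e = gridVal F β word (counterVal R ℓ k false x) (counterVal R ℓ k true x) := by
  induction hn : counterVal R ℓ k false x + counterVal R ℓ k true x using Nat.strong_induction_on
    generalizing x m e with
  | h n ih =>
    rcases h.child x hx false with hz | ⟨y, hxy, hy, hc, hd⟩
    · rw [h.counterVal_of_zero hx hz, gridVal]
      exact h.eq_getD he hx hm (h.word x hx hz)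
    · obtain ⟨hv1, hv2⟩ := h.counterVal_child hx hm hxy hy hc hd
      rw [Bool.not_false] at hv2
      rcases h.child x hx true with hz | ⟨y', hxy', hy', hc', hd'⟩
      · rw [h.counterVal_of_zero hx hz, hv1, gridVal]
        exact by_contra fun hne => h.border x hx ⟨hz, ⟨y, hxy, hy, hc, trivial⟩, e, hne, he⟩
      · obtain ⟨hv3, hv4⟩ := h.counterVal_child hx hm hxy' hy' hc' hd'
        rw [Bool.not_true] at hv4
        obtain ⟨e₁, he₁⟩ := h.data y hy
        obtain ⟨e₂, he₂⟩ := h.data y' hy'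
        have i1 := ih _ (by omega) hy hd he₁ rfl
        have i2 := ih _ (by omega) hy' hd' he₂ rfl
        -- Both entries are rewritten in terms of the first counter of `y` and the second counter of
        -- `y'`, to match the recursive clause of `gridVal`.
        rw [← hv2, hv3] at i1
        rw [← hv4, hv1] at i2
        rw [hv1, hv3, gridVal, ← i1, ← i2]
        exact by_contra fun hne => h.rule x hx
          ⟨e, e₁, e₂, hne, he, ⟨y, hxy, hy, hc, he₁⟩, ⟨y', hxy', hy', hc', he₂⟩⟩

theorem exists_gridVal_mem (h : IsComputation R ℓ k F β word acc) :
    ∃ u v, gridVal F β word u v ∈ acc := by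
  obtain ⟨x, hx, hm, e, he, hd⟩ := h.root
  exact ⟨_, _, h.data_eq_gridVal hx hm hd ▸ he⟩

end IsComputation

end Soundness

/-! ### The computation tree of a grid automaton -/

/-- What the address tree below a node has to encode: its depth, the two numbers, the counter that
has been decremented and the mark. -/
structure AddrView where
  depth : ℕ
  val : Bool → ℕ
  ctr : Bool
  mark : Mark

/-- The lower or upper half of the bits of a number below `2 ^ 2 ^ (j + 1)`. -/
def halfBits (j : ℕ) (b : Bool) (n : ℕ) : ℕ :=
  if b then n / 2 ^ 2 ^ j else n % 2 ^ 2 ^ j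

/-- The mark of a child in the address tree, where `n` is the decremented number. -/
def subMark (j n : ℕ) (b : Bool) : Mark → Mark
  | .same => .same
  | .bor => .bor
  | .dec =>
    if n % 2 ^ 2 ^ j + 1 = 2 ^ 2 ^ j then bif b then .dec else .bor else bif b then .same else .dec

/-- The part of the address tree on side `b`. -/
def AddrView.sub (v : AddrView) (b : Bool) : AddrView where
  depth := v.depth - 1
  val c := halfBits (v.depth - 1) b (v.val c)
  ctr := v.ctr
  mark := subMark (v.depth - 1) (v.val v.ctr) b v.mark

/-- The view `q` belongs to a child of a node with view `p`. -/
structure AddrView.IsPred (p q : AddrView) : Prop where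
  depth : q.depth = p.depth
  other : p.val (!q.ctr) = q.val (!q.ctr)
  ctr : MarkVal q.depth q.mark (p.val q.ctr) (q.val q.ctr)
  lt : ∀ c, p.val c < 2 ^ 2 ^ p.depth

theorem halfBits_lt {j n : ℕ} (b : Bool) (h : n < 2 ^ 2 ^ (j + 1)) :
    halfBits j b n < 2 ^ 2 ^ j := by
  rw [two_pow_two_pow_succ] at h
  unfold halfBits
  split_ifs
  · exact Nat.div_lt_of_lt_mul h
  · exact Nat.mod_lt _ (by positivity)

theorem halfBits_add_mul {j x y : ℕ} (hx : x < 2 ^ 2 ^ j) :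
    halfBits j false (x + 2 ^ 2 ^ j * y) = x ∧ halfBits j true (x + 2 ^ 2 ^ j * y) = y := by
  have hpos : 0 < 2 ^ 2 ^ j := by positivity
  simp [halfBits, Nat.add_mul_mod_self_left, Nat.mod_eq_of_lt hx, Nat.add_mul_div_left _ _ hpos,
    Nat.div_eq_of_lt hx]

/-- The converse of the halving argument in `TreeOK.addrVal_markRel`: subtracting `1` borrows from
the upper half precisely when the lower half of the result `n` consists of ones. -/
theorem markVal_halfBits {j m n : ℕ} {μ : Mark} (h : MarkVal (j + 1) μ m n) (b : Bool) :
    MarkVal j (subMark j n b μ) (halfBits j b m) (halfBits j b n) := by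
  have hpos : 0 < 2 ^ 2 ^ j := by positivity
  cases μ with
  | same =>
    simp only [MarkVal] at h
    subst h
    simp [subMark, MarkVal]
  | bor =>
    simp only [MarkVal, two_pow_two_pow_succ] at h
    obtain ⟨rfl, h⟩ := h
    -- A number with all bits set has both halves with all bits set.
    have hn : n = (2 ^ 2 ^ j - 1) + 2 ^ 2 ^ j * (2 ^ 2 ^ j - 1) := by
      rw [Nat.mul_sub_one]
      have := Nat.le_mul_self (2 ^ 2 ^ j)
      omega
    obtain ⟨h1, h2⟩ := halfBits_add_mul (y := 2 ^ 2 ^ j - 1) (Nat.sub_one_lt_of_lt hpos)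
    rw [← hn] at h1 h2
    cases b
    · exact ⟨by simp [halfBits], by omega⟩
    · exact ⟨by simp [halfBits], by omega⟩
  | dec =>
    simp only [MarkVal] at h
    have hn : n = n % 2 ^ 2 ^ j + 2 ^ 2 ^ j * (n / 2 ^ 2 ^ j) := (Nat.mod_add_div _ _).symm
    have hlt := Nat.mod_lt n hpos
    obtain ⟨h1, h2⟩ := halfBits_add_mul (y := n / 2 ^ 2 ^ j) hlt
    rw [← hn] at h1 h2
    by_cases hc : n % 2 ^ 2 ^ j + 1 = 2 ^ 2 ^ j
    -- Here `m = n + 1` carries into the upper half; in the other case it does not.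
    · have hm : m = 0 + 2 ^ 2 ^ j * (n / 2 ^ 2 ^ j + 1) := by rw [mul_add]; omega
      obtain ⟨h3, h4⟩ := halfBits_add_mul (y := n / 2 ^ 2 ^ j + 1) hpos
      rw [← hm] at h3 h4
      cases b
      · simp only [subMark, hc, if_true, cond_false, MarkVal, h1, h3, true_and]
      · simp only [subMark, hc, if_true, cond_true, MarkVal, h2, h4]
    · have hm : m = (n % 2 ^ 2 ^ j + 1) + 2 ^ 2 ^ j * (n / 2 ^ 2 ^ j) := by omega
      obtain ⟨h3, h4⟩ := halfBits_add_mul (j := j) (x := n % 2 ^ 2 ^ j + 1) (y := n / 2 ^ 2 ^ j)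
        (by omega)
      rw [← hm] at h3 h4
      cases b
      · simp only [subMark, hc, if_false, cond_false, MarkVal, h1, h3]
      · simp only [subMark, hc, if_false, cond_true, MarkVal, h2, h4]

/-- The invariant of a simultaneous descent in the address trees of a node and its child. -/
theorem AddrView.IsPred.sub {p q : AddrView} (h : p.IsPred q) (hd : p.depth ≠ 0) (b : Bool) :
    (p.sub b).IsPred (q.sub b) := by
  obtain ⟨j, hj⟩ := Nat.exists_eq_succ_of_ne_zero hd
  have hj' : q.depth = j + 1 := h.depth.trans hj
  have h1 := h.lt
  have h2 := h.ctr
  rw [hj, Nat.succ_eq_add_one] at h1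
  rw [hj'] at h2
  refine ⟨by simp [AddrView.sub, h.depth], ?_, ?_, fun c => ?_⟩
  · simp only [AddrView.sub, h.depth, h.other]
  · simp only [AddrView.sub, hj, hj', Nat.succ_sub_one]
    exact markVal_halfBits h2 b
  · simp only [AddrView.sub, hj, Nat.succ_sub_one]
    exact halfBits_lt b (h1 c)

/-- The states of the unfolding: configurations (the Boolean tells which counter was decremented
last), nodes in address trees, and nodes on paths that carry data. -/
inductive NodeState
  | cfg (c : Option Bool) (n : Bool → ℕ)
  | addr (b : Bool) (v : AddrView)
  | data (e : ℕ)

/-- The directions of the edges. -/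
inductive Direction
  | child (c : Bool)
  | addr (b : Bool)
  | data

instance Direction.instFinite : Finite Direction := by
  refine Finite.of_injective (β := Fin 3 × Bool) (fun
    | .child c => (0, c)
    | .addr b => (1, b)
    | .data => (2, false)) fun x y => ?_
  cases x <;> cases y <;> simp

namespace NodeState

variable (k : ℕ) {d : ℕ} (g : ℕ → ℕ → Fin (d + 1))

/-- The address tree below a state. -/
def view : NodeState → AddrView
  | cfg c n => ⟨k, n, c.getD false, if c.isSome then .dec else .same⟩
  | addr _ v => v
  | data _ => ⟨0, fun _ => 0, false, .same⟩

/-- The datum of a state. -/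
def datum : NodeState → Option ℕ
  | cfg _ n => some (g (n false) (n true))
  | addr _ _ => none
  | data e => some e

/-- The edges of the unfolding. -/
def next : Direction → NodeState → Option NodeState
  | .child c, s =>
    match s with
    | cfg _ n => if n c = 0 then none else some (cfg (some c) (Function.update n c (n c - 1)))
    | _ => none
  | .addr b, s => if (s.view k).depth = 0 then none else some (addr b ((s.view k).sub b))
  | .data, s =>
    match s.datum g with
    | some (e + 1) => some (data e)
    | _ => none

/-- The labels of the unfolding. -/
def HasLab : Lab → NodeState → Prop
  | .cfg, s => ∃ c n, s = cfg c n
  | .addr b, s => ∃ v, s = addr b v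
  | .bit c b, s => b = true ↔ (s.view k).val c = 1
  | .mark m, s => (s.view k).mark = m
  | .child c, s => ∃ n, s = cfg (some c) n
  | .zero c, s => ∃ c' n, s = cfg c' n ∧ n c = 0
  | .path, s => ∃ e, s = data e
  | .last, s => s.datum g = some 0

/-- A bound on the length of the paths from a state. -/
def rank : NodeState → ℕ
  | cfg _ n => n false + n true + k + d + 1
  | addr _ v => v.depth
  | data e => e

variable {k g}

theorem next_eq_cfg {x : Direction} {s : NodeState} {c : Option Bool} {n : Bool → ℕ}
    (h : next k g x s = some (cfg c n)) :
    ∃ c' c₀ n₀, x = .child c' ∧ s = cfg c₀ n₀ ∧ n₀ c' ≠ 0 ∧ c = some c' ∧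
      n = Function.update n₀ c' (n₀ c' - 1) := by
  cases x with
  | child c' =>
    cases s with
    | cfg c₀ n₀ =>
      simp only [next] at h
      split_ifs at h with h0
      cases h
      exact ⟨c', c₀, n₀, rfl, rfl, h0, rfl, rfl⟩
    | addr => cases h
    | data => cases h
  | addr b =>
    simp only [next] at h
    split_ifs at h
    cases h
  | data =>
    simp only [next] at h
    split at h <;> cases h

theorem next_eq_addr {x : Direction} {s : NodeState} {b : Bool} {v : AddrView}
    (h : next k g x s = some (addr b v)) :
    (s.view k).depth ≠ 0 ∧ v = (s.view k).sub b := by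
  cases x with
  | child c' =>
    cases s with
    | cfg c₀ n₀ =>
      simp only [next] at h
      split_ifs at h with h0
      cases h
    | addr => cases h
    | data => cases h
  | addr b =>
    simp only [next] at h
    split_ifs at h with h0
    cases h
    exact ⟨h0, rfl⟩
  | data =>
    simp only [next] at h
    split at h <;> cases h

theorem next_eq_data {x : Direction} {s : NodeState} {e : ℕ}
    (h : next k g x s = some (data e)) : s.datum g = some (e + 1) := by
  cases x with
  | child c' =>
    cases s with
    | cfg c₀ n₀ =>
      simp only [next] at h
      split_ifs at h with h0
      cases h
    | addr => cases h
    | data => cases h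
  | addr b =>
    simp only [next] at h
    split_ifs at h with h0
    cases h
  | data =>
    simp only [next] at h
    split at h
    · next hs => cases h; exact hs
    · cases h

/-- The strict decrease bounds the length of all paths, so the unfolding is finite. The summands `k`
and `d` of the rank pay for entering an address tree or a data path. -/
theorem rank_lt {x : Direction} {s s' : NodeState} (h : next k g x s = some s') :
    s'.rank k (d := d) < s.rank k (d := d) := by
  cases s' with
  | cfg c n =>
    obtain ⟨c', c₀, n₀, -, rfl, h0, -, rfl⟩ := next_eq_cfg h
    cases c' <;> simp [rank] <;> omega
  | addr b v =>
    obtain ⟨h0, rfl⟩ := next_eq_addr h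
    cases s with
    | cfg c n =>
      simp only [rank, AddrView.sub, view] at h0 ⊢
      omega
    | addr b' v' =>
      simp only [rank, AddrView.sub, view] at h0 ⊢
      omega
    | data e => exact absurd rfl h0
  | data e =>
    have h0 := next_eq_data h
    cases s with
    | cfg c n =>
      simp only [datum, Option.some.injEq] at h0
      have := (g (n false) (n true)).isLt
      simp only [rank]
      omega
    | addr b' v' => cases h0
    | data e' =>
      simp only [datum, Option.some.injEq] at h0
      simp only [rank]
      omega

end NodeState

/-- `st` exhibits a labelled graph as an unfolding of the computation of a grid automaton with
entries `g`, from the entry with coordinates `n`. -/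
structure IsUnfolding {M : Type} (R : M → M → Prop) (ℓ : Lab → M → Prop) (k : ℕ) {d : ℕ}
    (g : ℕ → ℕ → Fin (d + 1)) (n : Bool → ℕ) (st : M → NodeState) : Prop where
  lab : ∀ l x, ℓ l x ↔ (st x).HasLab k g l
  fwd : ∀ x y, R x y → ∃ a, NodeState.next k g a (st x) = some (st y)
  bwd : ∀ x a s, NodeState.next k g a (st x) = some s → ∃ y, R x y ∧ st y = s
  root : ∃ x, st x = .cfg none n
  le : ∀ x c m, st x = .cfg c m → ∀ i, m i ≤ n i

/-! ### Address trees and counters in an unfolding. -/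

namespace IsUnfolding

open NodeState

variable {M : Type} {R : M → M → Prop} {ℓ : Lab → M → Prop} {k d : ℕ}
  {g : ℕ → ℕ → Fin (d + 1)} {n : Bool → ℕ} {st : M → NodeState}

theorem dataAt_iff (h : IsUnfolding R ℓ k g n st) {e : ℕ} {x : M} :
    DataAt R ℓ e x ↔ (st x).datum g = some e := by
  induction e generalizing x with
  | zero => exact h.lab _ _
  | succ e ih =>
    constructor
    · rintro ⟨y, hxy, hp, hd⟩
      rw [h.lab] at hp
      obtain ⟨e', he'⟩ := hp
      rw [ih, he'] at hd
      cases hd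
      obtain ⟨a, ha⟩ := h.fwd x y hxy
      rw [he'] at ha
      exact next_eq_data ha
    · intro hx
      obtain ⟨y, hxy, hy⟩ := h.bwd x .data (.data e) (by simp [next, hx])
      exact ⟨y, hxy, (h.lab _ _).2 ⟨e, hy⟩, ih.2 (by rw [hy]; rfl)⟩

theorem dataAt_iff_of_cfg (h : IsUnfolding R ℓ k g n st) {e : Fin (d + 1)} {x : M}
    {c : Option Bool} {m : Bool → ℕ} (hx : st x = .cfg c m) :
    DataAt R ℓ e x ↔ e = g (m false) (m true) := by
  rw [h.dataAt_iff, hx, datum, Option.some.injEq, Fin.val_inj, eq_comm]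

theorem hasChild (h : IsUnfolding R ℓ k g n st) {x : M} {c : Option Bool} {m : Bool → ℕ}
    (hx : st x = .cfg c m) {i : Bool} {P : M → Prop} (hc : HasChild R ℓ i P x) :
    m i ≠ 0 ∧ ∃ y, R x y ∧ st y = .cfg (some i) (Function.update m i (m i - 1)) ∧ P y := by
  obtain ⟨y, hxy, -, hy, hP⟩ := hc
  rw [h.lab] at hy
  obtain ⟨m', hy⟩ := hy
  obtain ⟨a, ha⟩ := h.fwd x y hxy
  rw [hy] at ha
  obtain ⟨c', c₀, n₀, -, h1, h2, h3, h4⟩ := next_eq_cfg ha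
  rw [hx] at h1
  cases h1
  cases h3
  exact ⟨h2, y, hxy, by rw [hy, h4], hP⟩

theorem view_of_addr (h : IsUnfolding R ℓ k g n st) {x y : M} (hxy : R x y) {b : Bool}
    (hb : ℓ (.addr b) y) :
    ((st x).view k).depth ≠ 0 ∧ (st y).view k = ((st x).view k).sub b := by
  rw [h.lab] at hb
  obtain ⟨v, hv⟩ := hb
  obtain ⟨a, ha⟩ := h.fwd x y hxy
  rw [hv] at ha
  obtain ⟨h1, h2⟩ := next_eq_addr ha
  exact ⟨h1, by rw [hv, h2]; rfl⟩

theorem hasSide (h : IsUnfolding R ℓ k g n st) {x : M} (hx : ((st x).view k).depth ≠ 0)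
    (b : Bool) : HasSide R ℓ b (((st x).view k).sub b).mark x := by
  obtain ⟨y, hxy, hy⟩ := h.bwd x (.addr b) _ (if_neg hx)
  exact ⟨y, hxy, (h.lab _ _).2 ⟨_, hy⟩, (h.lab _ _).2 (by rw [hy]; rfl)⟩

theorem treeOK (h : IsUnfolding R ℓ k g n st) {j : ℕ} {x : M}
    (hx : ((st x).view k).depth = j) : TreeOK R ℓ j x := by
  induction j generalizing x with
  | zero =>
    have key : ∀ c, ℓ (.bit c false) x ∨ ℓ (.bit c true) x := fun c => by
      rw [h.lab, h.lab]
      simp only [HasLab]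
      by_cases hc : ((st x).view k).val c = 1 <;> simp [hc]
    exact ⟨key false, key true⟩
  | succ j ih =>
    have hx0 : ((st x).view k).depth ≠ 0 := by omega
    refine ⟨fun m hm => ?_, fun y hxy hy => ?_⟩
    · rw [h.lab] at hm
      simp only [HasLab] at hm
      have h1 := h.hasSide hx0 false
      have h2 := h.hasSide hx0 true
      simp only [AddrView.sub, hm, subMark] at h1 h2
      cases m with
      | same => exact ⟨h1, h2⟩
      | bor => exact ⟨h1, h2⟩
      | dec =>
        simp only at h1 h2
        split_ifs at h1 h2
        · exact .inr ⟨h1, h2⟩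
        · exact .inl ⟨h1, h2⟩
    · apply ih
      rcases hy with hy | hy <;> rw [(h.view_of_addr hxy hy).2, AddrView.sub, hx] <;> rfl

/-- The descent preserves `AddrView.IsPred`. At depth `0` the numbers are single bits, and `MarkVal`
contradicts each kind of conflict. -/
theorem not_counterBad_child (h : IsUnfolding R ℓ k g n st) {x y z z' : M} {c : Bool}
    {a : List Bool} (hz : AddrWalk R ℓ a x z) (hz' : AddrWalk R ℓ a y z')
    (ha : ((st x).view k).depth = a.length) (hp : ((st x).view k).IsPred ((st y).view k))
    (hc : ((st y).view k).ctr = c) : ¬ (DecBad ℓ c z z' ∨ SameBad ℓ (!c) z z') := by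
  induction a generalizing x y with
  | nil =>
    cases hz
    cases hz'
    subst hc
    have hbit : ∀ {c b x}, ℓ (.bit c b) x → (b = true ↔ ((st x).view k).val c = 1) :=
      fun hl => (h.lab _ _).1 hl
    have hmark : ∀ {m x}, ℓ (.mark m) x → ((st x).view k).mark = m := fun hl => (h.lab _ _).1 hl
    have hlt := hp.lt
    have hctr := hp.ctr
    have ho := hp.other
    rw [hp.depth, ha] at hctr
    rw [ha] at hlt
    -- At depth `0` the bound is `2 ^ 2 ^ 0 = 2`, so failing to be `1` means being `0`.
    have h0 := hlt ((st z').view k).ctr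
    simp only [List.length_nil, pow_zero, pow_one] at h0
    rintro ((⟨hm, hb⟩ | ⟨hm, hb⟩ | ⟨hm, hb⟩) | hb)
    all_goals
      try (rw [hmark hm] at hctr)
      simp only [MarkVal, List.length_nil, pow_zero, pow_one] at hctr
    · rcases hb with ⟨h1, h2⟩ | ⟨h1, h2⟩ <;>
        have h3 := hbit h1 <;> have h4 := hbit h2 <;> simp at h3 h4 <;> omega
    · rcases hb with h1 | h1 <;> have h3 := hbit h1 <;> simp at h3 <;> omega
    · rcases hb with h1 | h1 <;> have h3 := hbit h1 <;> simp at h3 <;> omega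
    · rcases hb with ⟨h1, h2⟩ | ⟨h1, h2⟩ <;>
        have h3 := hbit h1 <;> have h4 := hbit h2 <;> simp at h3 h4 <;> omega
  | cons b a ih =>
    obtain ⟨x', hx, hxb, hz⟩ := hz
    obtain ⟨y', hy, hyb, hz'⟩ := hz'
    obtain ⟨hd, hx'⟩ := h.view_of_addr hx hxb
    obtain ⟨-, hy'⟩ := h.view_of_addr hy hyb
    refine ih hz hz' ?_ ?_ ?_
    · rw [hx', AddrView.sub, ha]
      rfl
    · rw [hx', hy']
      exact hp.sub hd b
    · rw [hy', ← hc]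
      rfl

/-- The leaf view is determined by the top view and the address, so leaves with the same address
below one node agree. -/
theorem view_of_addrWalk (h : IsUnfolding R ℓ k g n st) {x z : M} {a : List Bool}
    (hz : AddrWalk R ℓ a x z) : (st z).view k = a.foldl AddrView.sub ((st x).view k) := by
  induction a generalizing x with
  | nil => cases hz; rfl
  | cons b a ih =>
    obtain ⟨y, hxy, hb, hz⟩ := hz
    rw [ih hz, (h.view_of_addr hxy hb).2]
    rfl

theorem foldl_sub_val_eq_zero {v : AddrView} {c : Bool} (h : v.val c = 0) (a : List Bool) :
    (a.foldl AddrView.sub v).val c = 0 := by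
  induction a generalizing v with
  | nil => exact h
  | cons b a ih =>
    apply ih
    simp [AddrView.sub, halfBits, h]

/-- Bits at one address agree, halves of zero are zero, and a configuration child is a predecessor
in the sense of `AddrView.IsPred`. The bound on `n` makes the numbers fit into trees of depth `k`.
-/
theorem not_counterBad (h : IsUnfolding R ℓ k g n st) (hn : ∀ i, n i < 2 ^ 2 ^ k) {x y z z' : M}
    (hx : ℓ .cfg x) {a : List Bool} (ha : a.length = k) (hz : AddrWalk R ℓ a x z)
    (hz' : AddrWalk R ℓ a y z') : ¬ CounterBad R ℓ x y z z' := by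
  have hbit : ∀ {c b x}, ℓ (.bit c b) x → (b = true ↔ ((st x).view k).val c = 1) :=
    fun hl => (h.lab _ _).1 hl
  rw [h.lab] at hx
  obtain ⟨c₀, m, hx⟩ := hx
  rintro (⟨rfl, c, ⟨h1, h2⟩ | ⟨h1, h2⟩⟩ | ⟨hxy, c, hc, hbad⟩)
  · have h3 := hbit h1
    have h4 := hbit h2
    rw [h.view_of_addrWalk hz] at h3
    rw [h.view_of_addrWalk hz'] at h4
    simp only [Bool.false_eq_true, false_iff, true_iff] at h3 h4
    exact h3 h4
  · have h3 := hbit h2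
    rw [h.lab] at h1
    obtain ⟨c', n', hx', h0⟩ := h1
    rw [h.view_of_addrWalk hz, foldl_sub_val_eq_zero (by rw [hx']; exact h0)] at h3
    simp at h3
  · rw [h.lab] at hc
    obtain ⟨m', hy⟩ := hc
    obtain ⟨a', ha'⟩ := h.fwd x y hxy
    rw [hy, hx] at ha'
    obtain ⟨c', c₁, n₀, -, h1, h2, h3, h4⟩ := next_eq_cfg ha'
    cases h1
    cases h3
    refine h.not_counterBad_child hz hz' (by rw [hx, ha]; rfl) ?_ (by rw [hy]; rfl) hbad
    rw [hx, hy, h4]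
    refine ⟨rfl, ?_, ?_, fun i => (h.le x _ _ hx i).trans_lt (hn i)⟩
    · cases c <;> simp [view]
    · simp only [view, Option.isSome, if_true, MarkVal, Option.getD, Function.update_self]
      omega

end IsUnfolding

/-! ### Every unfolding from an accepting entry is a computation. -/

namespace IsUnfolding

open NodeState

variable {M : Type} {R : M → M → Prop} {ℓ : Lab → M → Prop} {k d : ℕ}
  {F : Fin (d + 1) → Fin (d + 1) → Fin (d + 1)} {β : Fin (d + 1)} {word : List (Fin (d + 1))}
  {n : Bool → ℕ} {st : M → NodeState}

theorem dataNe_iff {g : ℕ → ℕ → Fin (d + 1)} (h : IsUnfolding R ℓ k g n st) {e : Fin (d + 1)}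
    {x : M} {c : Option Bool} {m : Bool → ℕ} (hx : st x = .cfg c m) :
    DataNe R ℓ e x ↔ g (m false) (m true) ≠ e := by
  simp only [DataNe, h.dataAt_iff_of_cfg hx]
  exact ⟨fun ⟨e', h1, h2⟩ => h2 ▸ h1, fun h1 => ⟨_, h1, rfl⟩⟩

/-- The hypothesis `hl` is invariant under dropping a letter and decrementing the second counter of
`y`. -/
theorem not_wordBad {g : ℕ → ℕ → Fin (d + 1)} (h : IsUnfolding R ℓ k g n st) {x y : M}
    {c c' : Option Bool} {m m' : Bool → ℕ} (hx : st x = .cfg c m) (hy : st y = .cfg c' m')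
    {l : List (Fin (d + 1))} (hl : g (m false) (m true) = l.getD (m' true) β) :
    ¬ WordBad R ℓ β l x y := by
  induction l generalizing y c' m' with
  | nil => exact fun hb => (h.dataNe_iff hx).1 hb hl
  | cons e l ih =>
    rintro (⟨hz, hb⟩ | hb)
    · rw [h.lab] at hz
      obtain ⟨c₁, m₁, h1, h2⟩ := hz
      rw [hy] at h1
      cases h1
      rw [h2] at hl
      exact (h.dataNe_iff hx).1 hb hl
    · obtain ⟨h0, z, -, hz, hb⟩ := h.hasChild hy hb
      refine ih hz ?_ hb
      obtain ⟨v, hv⟩ := Nat.exists_eq_succ_of_ne_zero h0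
      simpa [hv] using hl

theorem isComputation (h : IsUnfolding R ℓ k (gridVal F β word) n st)
    (hn : ∀ i, n i < 2 ^ 2 ^ k) {acc : Set (Fin (d + 1))}
    (hacc : gridVal F β word (n false) (n true) ∈ acc) : IsComputation R ℓ k F β word acc where
  root := by
    obtain ⟨x, hx⟩ := h.root
    refine ⟨x, ?_, ?_, _, hacc, (h.dataAt_iff_of_cfg hx).2 rfl⟩
    · rw [h.lab, hx]
      exact ⟨_, _, rfl⟩
    · rw [h.lab, hx]
      rfl
  data x hx := by
    rw [h.lab] at hx
    obtain ⟨c, m, hx⟩ := hx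
    exact ⟨_, (h.dataAt_iff_of_cfg hx).2 rfl⟩
  child x hx i := by
    rw [h.lab] at hx
    obtain ⟨c, m, hx⟩ := hx
    by_cases hi : m i = 0
    · left
      rw [h.lab]
      exact ⟨c, m, hx, hi⟩
    · right
      obtain ⟨y, hxy, hy⟩ := h.bwd x (.child i) _ (by rw [hx]; exact if_neg hi)
      refine ⟨y, hxy, ?_, ?_, ?_⟩ <;> rw [h.lab, hy]
      · exact ⟨_, _, rfl⟩
      · exact ⟨_, rfl⟩
      · rfl
  rule x hx := by
    rintro ⟨e, e₁, e₂, hne, he, h1, h2⟩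
    rw [h.lab] at hx
    obtain ⟨c, m, hx⟩ := hx
    obtain ⟨hu, y, -, hy, he₁⟩ := h.hasChild hx h1
    obtain ⟨hv, y', -, hy', he₂⟩ := h.hasChild hx h2
    rw [h.dataAt_iff_of_cfg hx] at he
    rw [h.dataAt_iff_of_cfg hy] at he₁
    rw [h.dataAt_iff_of_cfg hy'] at he₂
    obtain ⟨u, hu⟩ := Nat.exists_eq_succ_of_ne_zero hu
    obtain ⟨v, hv⟩ := Nat.exists_eq_succ_of_ne_zero hv
    apply hne
    simp [he, he₁, he₂, hu, hv, gridVal]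
  border x hx := by
    rintro ⟨hz, hc, hb⟩
    rw [h.lab] at hz
    obtain ⟨c, m, hx, h0⟩ := hz
    obtain ⟨hu, -⟩ := h.hasChild hx hc
    obtain ⟨u, hu⟩ := Nat.exists_eq_succ_of_ne_zero hu
    exact (h.dataNe_iff hx).1 hb (by rw [h0, hu, gridVal])
  counter x y hx _ a ha z z' hz hz' := h.not_counterBad hn hx ha hz hz'
  tree x hx := by
    rw [h.lab] at hx
    obtain ⟨c, m, hx⟩ := hx
    exact h.treeOK (by rw [hx]; rfl)
  word x _ hz := by
    rw [h.lab] at hz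
    obtain ⟨c, m, hx, h0⟩ := hz
    exact h.not_wordBad hx hx (by rw [h0, gridVal])

end IsUnfolding

/-! ### The tree as a structure -/

/-- The number of labels. -/
noncomputable def numLab : ℕ := Nat.card Lab

/-- A numbering of the labels. -/
noncomputable def labEquiv : Lab ≃ Fin numLab := Finite.equivFin Lab

/-- A node has a label in a structure. -/
def HasLabel {M : Type} (S : (treeSig numLab).Structure M) (l : Lab) (x : M) : Prop :=
  S.RelMap (TreeRel.label (labEquiv l) : (treeSig numLab).Relations 1) ![x]

/-- The structure of a labelled graph. -/
@[reducible]
def graphStructure {M : Type} (R : M → M → Prop) (ℓ : Lab → M → Prop) :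
    (treeSig numLab).Structure M where
  funMap := fun f => Empty.elim f
  RelMap := fun {_} r v =>
    match r, v with
    | TreeRel.child, v => R (v 0) (v 1)
    | TreeRel.label i, v => ℓ (labEquiv.symm i) (v 0)

theorem isChild_graphStructure {M : Type} (R : M → M → Prop) (ℓ : Lab → M → Prop) :
    IsChild (graphStructure R ℓ) = R := rfl

theorem hasLabel_graphStructure {M : Type} (R : M → M → Prop) (ℓ : Lab → M → Prop) :
    HasLabel (graphStructure R ℓ) = ℓ := by
  funext l x
  change ℓ (labEquiv.symm (labEquiv l)) x = ℓ l x
  rw [Equiv.symm_apply_apply]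

/-! ### Paths of the unfolding as nodes of a finite tree. -/

section Tree

open NodeState

variable (k : ℕ) {d : ℕ} (g : ℕ → ℕ → Fin (d + 1)) (n : Bool → ℕ)

/-- The state reached along a path, which is given in reverse order. -/
def pathState : List Direction → Option NodeState
  | [] => some (.cfg none n)
  | a :: l => (pathState l).bind (NodeState.next k g a)

/-- The nodes of the computation tree. -/
def CompTree : Type := {l : List Direction // (pathState k g n l).isSome}

variable {k g n}

/-- The state of a node of the computation tree. -/
def CompTree.state (x : CompTree k g n) : NodeState := (pathState k g n x.1).get x.2

/-- The edges of the computation tree. -/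
def CompTree.Edge (x y : CompTree k g n) : Prop := ∃ a, y.1 = a :: x.1

theorem CompTree.pathState_eq (x : CompTree k g n) : pathState k g n x.1 = some x.state :=
  (Option.some_get x.2).symm

theorem CompTree.next_state {x y : CompTree k g n} {a : Direction} (h : y.1 = a :: x.1) :
    NodeState.next k g a x.state = some y.state := by
  have := y.pathState_eq
  rwa [h, pathState, x.pathState_eq] at this

theorem CompTree.length_add_rank_le {l : List Direction} {s : NodeState}
    (h : pathState k g n l = some s) :
    l.length + s.rank k (d := d) ≤ (NodeState.cfg none n).rank k (d := d) := by
  induction l generalizing s with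
  | nil => cases h; simp
  | cons a l ih =>
    rw [pathState] at h
    obtain ⟨s', hs', h⟩ := Option.bind_eq_some_iff.1 h
    have h1 := ih hs'
    have h2 := NodeState.rank_lt h
    simp only [List.length_cons]
    omega

instance CompTree.instFinite : Finite (CompTree k g n) :=
  Set.Finite.to_subtype <| (List.finite_length_le Direction
    ((NodeState.cfg none n).rank k (d := d))).subset fun l hl => by
      obtain ⟨s, hs⟩ := Option.isSome_iff_exists.1 hl
      exact (Nat.le_add_right _ _).trans (CompTree.length_add_rank_le hs)

/-- The root of the computation tree. -/
def CompTree.root : CompTree k g n := ⟨[], rfl⟩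

/-- The parent of a node. -/
theorem CompTree.exists_parent {a : Direction} {l : List Direction}
    (h : (pathState k g n (a :: l)).isSome) : (pathState k g n l).isSome := by
  rw [pathState] at h
  cases hl : pathState k g n l with
  | none => rw [hl] at h; cases h
  | some s => rfl

theorem CompTree.isUnfolding :
    IsUnfolding CompTree.Edge (fun l (x : CompTree k g n) => x.state.HasLab k g l) k g n
      CompTree.state where
  lab _ _ := Iff.rfl
  fwd _ _ := fun ⟨a, ha⟩ => ⟨a, CompTree.next_state ha⟩
  bwd x a s hs := by
    have h : pathState k g n (a :: x.1) = some s := by rw [pathState, x.pathState_eq]; exact hs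
    refine ⟨⟨a :: x.1, by rw [h]; rfl⟩, ⟨a, rfl⟩, ?_⟩
    exact Option.some_injective _ ((CompTree.pathState_eq _).symm.trans h)
  root := ⟨CompTree.root, rfl⟩
  le := by
    rintro ⟨l, hl⟩ c m hx i
    replace hx : pathState k g n l = some (.cfg c m) := by
      rw [← hx]; exact CompTree.pathState_eq ⟨l, hl⟩
    clear hl
    induction l generalizing c m with
    | nil => cases hx; exact le_rfl
    | cons a l ih =>
      rw [pathState] at hx
      obtain ⟨s, hs, h⟩ := Option.bind_eq_some_iff.1 hx
      obtain ⟨c', c₀, n₀, -, rfl, h0, -, rfl⟩ := next_eq_cfg h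
      refine le_trans ?_ (ih _ _ hs)
      by_cases hi : i = c'
      · subst hi; simp
      · simp [hi]

/-- Nodes are reversed paths, so the unique parent is the tail of the list and the root is the empty
list. -/
theorem CompTree.finiteTrees (ℓ : Lab → CompTree k g n → Prop) :
    finiteTrees numLab (CompTree k g n) (graphStructure CompTree.Edge ℓ) := by
  refine ⟨inferInstance, CompTree.root, ?_, ?_, ?_⟩ <;> rw [isChild_graphStructure]
  · rintro x ⟨a, ha⟩
    cases ha
  · rintro ⟨l, hl⟩ hy
    cases l with
    | nil => exact absurd rfl hy
    | cons a l =>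
      refine ⟨⟨l, CompTree.exists_parent hl⟩, ⟨a, rfl⟩, ?_⟩
      rintro ⟨l', hl'⟩ ⟨a', ha'⟩
      cases ha'
      rfl
  · rintro ⟨l, hl⟩
    induction l with
    | nil => exact .refl
    | cons a l ih => exact (ih (CompTree.exists_parent hl)).tail ⟨a, rfl⟩

end Tree

/-! ### Formulas describing computations -/

/-- `φ` is a formula of the unary-negation fragment with free variables in `X` and negation depth
at most `n`. -/
def FOFormula.Ok {σ : FirstOrder.Language.{0, 0}} (φ : FOFormula σ) (X : Finset ℕ) (n : ℕ) :
    Prop :=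
  φ.IsUNFO ∧ φ.freeVars ⊆ X ∧ φ.negDepth ≤ n

namespace FOFormula

section Ok

variable {σ : FirstOrder.Language.{0, 0}} {φ ψ : FOFormula σ} {X Y : Finset ℕ} {n m x y : ℕ}

theorem Ok.mono (h : φ.Ok X n) (hX : X ⊆ Y) (hn : n ≤ m) : φ.Ok Y m :=
  ⟨h.1, h.2.1.trans hX, h.2.2.trans hn⟩

theorem Ok.neg (h : φ.Ok {x} n) : (φ.neg).Ok {x} (n + 1) :=
  ⟨⟨h.1, (Finset.card_le_card h.2.1).trans (by simp)⟩, h.2.1, Nat.succ_le_succ h.2.2⟩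

theorem Ok.neg_closed (h : φ.Ok ∅ n) : (φ.neg).Ok ∅ (n + 1) :=
  ⟨⟨h.1, (Finset.card_le_card h.2.1).trans (by simp)⟩, h.2.1, Nat.succ_le_succ h.2.2⟩

@[simp] theorem ok_and : (φ.and ψ).Ok X n ↔ φ.Ok X n ∧ ψ.Ok X n := by
  simp only [Ok, IsUNFO, freeVars, negDepth, Finset.union_subset_iff, max_le_iff]
  tauto

@[simp] theorem ok_or : (φ.or ψ).Ok X n ↔ φ.Ok X n ∧ ψ.Ok X n := by
  simp only [Ok, IsUNFO, freeVars, negDepth, Finset.union_subset_iff, max_le_iff]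
  tauto

@[simp] theorem ok_ex : (ex x φ).Ok X n ↔ φ.Ok (insert x X) n := by
  simp only [Ok, IsUNFO, freeVars, negDepth, Finset.subset_insert_iff]

@[simp] theorem ok_eq : (FOFormula.eq x y : FOFormula σ).Ok X n ↔ x ∈ X ∧ y ∈ X := by
  simp [Ok, IsUNFO, freeVars, negDepth, Finset.insert_subset_iff]

end Ok

/-- The edge relation. -/
def edgeF (x y : ℕ) : FOFormula (treeSig numLab) :=
  .rel (n := 2) (TreeRel.child : (treeSig numLab).Relations 2) ![x, y]

/-- A node label. -/
noncomputable def labF (l : Lab) (x : ℕ) : FOFormula (treeSig numLab) :=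
  .rel (n := 1) (TreeRel.label (labEquiv l) : (treeSig numLab).Relations 1) ![x]

@[simp] theorem ok_edgeF {X : Finset ℕ} {n x y : ℕ} : (edgeF x y).Ok X n ↔ x ∈ X ∧ y ∈ X := by
  simp only [edgeF, Ok, IsUNFO, freeVars, negDepth, Finset.subset_iff, Finset.mem_image,
    Finset.mem_univ, true_and, Nat.zero_le, and_true]
  constructor
  · exact fun h => ⟨h ⟨0, rfl⟩, h ⟨1, rfl⟩⟩
  · rintro ⟨hx, hy⟩ z ⟨i, rfl⟩
    fin_cases i
    · exact hx
    · exact hy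

@[simp] theorem ok_labF {l : Lab} {X : Finset ℕ} {n x : ℕ} : (labF l x).Ok X n ↔ x ∈ X := by
  simp only [labF, Ok, IsUNFO, freeVars, negDepth, Finset.subset_iff, Finset.mem_image,
    Finset.mem_univ, true_and, Nat.zero_le, and_true]
  constructor
  · exact fun h => h ⟨0, rfl⟩
  · rintro hx z ⟨i, rfl⟩
    fin_cases i
    exact hx

/-- Falsity. -/
def botF : FOFormula (treeSig numLab) := .ex 0 (.neg (.eq 0 0))

/-- A disjunction. -/
def orF (φ : FOFormula (treeSig numLab)) (l : List (FOFormula (treeSig numLab))) :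
    FOFormula (treeSig numLab) :=
  l.foldr .or φ

theorem ok_botF {X : Finset ℕ} {n : ℕ} (hn : 1 ≤ n) : botF.Ok X n := by
  rw [botF, ok_ex]
  refine Ok.mono (X := {0}) (n := 1) (Ok.neg (by simp)) (by simp) hn

theorem ok_orF {φ : FOFormula (treeSig numLab)} {l : List (FOFormula (treeSig numLab))}
    {X : Finset ℕ} {n : ℕ} (h : φ.Ok X n) (hl : ∀ ψ ∈ l, ψ.Ok X n) : (orF φ l).Ok X n := by
  induction l with
  | nil => exact h
  | cons ψ l ih =>
    exact ok_or.2 ⟨hl ψ List.mem_cons_self, ih fun χ hχ => hl χ (List.mem_cons_of_mem _ hχ)⟩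

/-- The node `x` carries the datum `e`; the second variable is auxiliary. -/
noncomputable def dataF : ℕ → ℕ → ℕ → FOFormula (treeSig numLab)
  | 0, x, _ => labF .last x
  | e + 1, x, y => .ex y (.and (edgeF x y) (.and (labF .path y) (dataF e y x)))

theorem ok_dataF {e : ℕ} {X : Finset ℕ} {n x y : ℕ} (hx : x ∈ X) : (dataF e x y).Ok X n := by
  induction e generalizing x y X with
  | zero => simpa [dataF]
  | succ e ih => simp [dataF, hx, ih]

section Data

variable {d : ℕ}

/-- The node `x` carries some datum. -/
noncomputable def someDataF (d x y : ℕ) : FOFormula (treeSig numLab) :=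
  orF (dataF 0 x y) ((List.finRange (d + 1)).map fun e : Fin (d + 1) => dataF e x y)

/-- The node `x` carries a datum from the set `A`. -/
noncomputable def dataMemF (A : Set (Fin (d + 1))) (x y : ℕ) : FOFormula (treeSig numLab) :=
  open Classical in
  orF botF (((List.finRange (d + 1)).filter (· ∈ A)).map fun e : Fin (d + 1) => dataF e x y)

/-- There is a child `y` of `x` for the counter `c` that satisfies `φ`. -/
noncomputable def childF (c : Bool) (x y : ℕ) (φ : FOFormula (treeSig numLab)) :
    FOFormula (treeSig numLab) :=
  .ex y (.and (edgeF x y) (.and (labF .cfg y) (.and (labF (.child c) y) φ)))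

theorem ok_someDataF {X : Finset ℕ} {n x y : ℕ} (hx : x ∈ X) : (someDataF d x y).Ok X n := by
  refine ok_orF (ok_dataF hx) fun ψ hψ => ?_
  obtain ⟨e, -, rfl⟩ := List.mem_map.1 hψ
  exact ok_dataF hx

theorem ok_dataMemF {A : Set (Fin (d + 1))} {X : Finset ℕ} {n x y : ℕ} (hx : x ∈ X)
    (hn : 1 ≤ n) : (dataMemF A x y).Ok X n := by
  refine ok_orF (ok_botF hn) fun ψ hψ => ?_
  obtain ⟨e, -, rfl⟩ := List.mem_map.1 hψ
  exact ok_dataF hx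

@[simp] theorem ok_childF {c : Bool} {φ : FOFormula (treeSig numLab)} {X : Finset ℕ} {n x y : ℕ} :
    (childF c x y φ).Ok X n ↔ x ∈ insert y X ∧ φ.Ok (insert y X) n := by
  simp [childF]

end Data

/-- See `HasSide`. -/
noncomputable def sideF (b : Bool) (m : Mark) : FOFormula (treeSig numLab) :=
  .ex 1 (.and (edgeF 0 1) (.and (labF (.addr b) 1) (labF (.mark m) 1)))

/-- See `MarkOK`. -/
noncomputable def markOKF : Mark → FOFormula (treeSig numLab)
  | .same => .and (sideF false .same) (sideF true .same)
  | .bor => .and (sideF false .bor) (sideF true .bor)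
  | .dec => .or (.and (sideF false .dec) (sideF true .same)) (.and (sideF false .bor) (sideF true .dec))

/-- See `LeafOK`. -/
noncomputable def leafOKF : FOFormula (treeSig numLab) :=
  .and (.or (labF (.bit false false) 0) (labF (.bit false true) 0))
    (.or (labF (.bit true false) 0) (labF (.bit true true) 0))

/-- A mark whose requirements are violated. -/
noncomputable def markBadF (m : Mark) : FOFormula (treeSig numLab) :=
  .and (labF (.mark m) 0) (.neg (markOKF m))

/-- One level of the formula describing defects of address trees. -/
noncomputable def treeStepF (φ : FOFormula (treeSig numLab)) : FOFormula (treeSig numLab) :=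
  .or (.or (markBadF .same) (.or (markBadF .dec) (markBadF .bor)))
    (.ex 1 (.and (edgeF 0 1) (.and (.or (labF (.addr false) 1) (labF (.addr true) 1))
      (.ex 0 (.and (.eq 0 1) φ)))))

theorem ok_markBadF (m : Mark) : (markBadF m).Ok {0} 1 := by
  refine ok_and.2 ⟨by simp, Ok.neg ?_⟩
  cases m <;> simp [markOKF, sideF]

/-- Defects of a tree are described rather than its correctness: the descent is existential, and
only the positive checks at a single node are negated. Therefore the negation depth does not grow
with `k`. -/
theorem ok_treeStepF (k : ℕ) : (treeStepF^[k] (.neg leafOKF)).Ok {0} 1 := by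
  induction k with
  | zero => exact Ok.neg (by simp [leafOKF])
  | succ k ih =>
    rw [Function.iterate_succ_apply']
    simp only [treeStepF, ok_or, ok_and, ok_ex, ok_markBadF, true_and]
    exact ⟨by simp, by simp, by simp, ih.mono (by simp) le_rfl⟩

/-- See `SameBad`. -/
noncomputable def sameBadF (c : Bool) : FOFormula (treeSig numLab) :=
  .or (.and (labF (.bit c false) 2) (labF (.bit c true) 3))
    (.and (labF (.bit c true) 2) (labF (.bit c false) 3))

/-- See `DecBad`. -/
noncomputable def decBadF (c : Bool) : FOFormula (treeSig numLab) :=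
  .or (.and (labF (.mark .same) 3) (sameBadF c))
    (.or (.and (labF (.mark .dec) 3) (.or (labF (.bit c false) 2) (labF (.bit c true) 3)))
      (.and (labF (.mark .bor) 3) (.or (labF (.bit c true) 2) (labF (.bit c false) 3))))

/-- The first part of `CounterBad`, for one counter. -/
noncomputable def selfBadF (c : Bool) : FOFormula (treeSig numLab) :=
  .or (.and (labF (.bit c false) 2) (labF (.bit c true) 3))
    (.and (labF (.zero c) 0) (labF (.bit c true) 2))

/-- The second part of `CounterBad`, for one counter. -/
noncomputable def childBadF (c : Bool) : FOFormula (treeSig numLab) :=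
  .and (labF (.child c) 1) (.or (decBadF c) (sameBadF !c))

/-- See `CounterBad`. -/
noncomputable def counterBadF : FOFormula (treeSig numLab) :=
  .or (.and (.eq 0 1) (.or (selfBadF false) (selfBadF true)))
    (.and (edgeF 0 1) (.or (childBadF false) (childBadF true)))

/-- One level of a simultaneous descent in two address trees. -/
noncomputable def descendF (φ : FOFormula (treeSig numLab)) : FOFormula (treeSig numLab) :=
  .ex 4 (.and (edgeF 2 4) (.ex 5 (.and (edgeF 3 5)
    (.and (.or (.and (labF (.addr false) 4) (labF (.addr false) 5))
      (.and (labF (.addr true) 4) (labF (.addr true) 5)))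
      (.ex 2 (.and (.eq 2 4) (.ex 3 (.and (.eq 3 5) φ))))))))

/-- The formula has several free variables, so it must be free of negation; in `counterS` it is
negated only after all variables are quantified. -/
theorem ok_descendF (k : ℕ) : (descendF^[k] counterBadF).Ok {0, 1, 2, 3} 0 := by
  induction k with
  | zero => simp [counterBadF, selfBadF, childBadF, decBadF, sameBadF]
  | succ k ih =>
    rw [Function.iterate_succ_apply']
    simp only [descendF, ok_or, ok_and, ok_ex, ok_edgeF, ok_labF, ok_eq]
    simp only [Finset.mem_insert, Finset.mem_singleton, true_or, or_true, true_and, and_self]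
    exact ih.mono (by intro i; simp; tauto) le_rfl

section Automaton

variable {d : ℕ} (F : Fin (d + 1) → Fin (d + 1) → Fin (d + 1)) (β : Fin (d + 1))
  (acc : Set (Fin (d + 1))) (k : ℕ)

/-- One letter of the formula describing conflicts with the word. -/
noncomputable def wordStepF (e : Fin (d + 1)) (φ : FOFormula (treeSig numLab)) :
    FOFormula (treeSig numLab) :=
  .or (.and (labF (.zero true) 1) (dataMemF {e}ᶜ 0 2))
    (childF true 1 2 (.ex 1 (.and (.eq 1 2) φ)))

/-- See `WordBad`. -/
noncomputable def wordBadF (word : List (Fin (d + 1))) : FOFormula (treeSig numLab) :=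
  word.foldr wordStepF (dataMemF {β}ᶜ 0 2)

theorem ok_wordBadF (word : List (Fin (d + 1))) : (wordBadF β word).Ok {0, 1} 1 := by
  induction word with
  | nil => exact ok_dataMemF (by simp) le_rfl
  | cons e word ih =>
    change (wordStepF e (wordBadF β word)).Ok _ _
    simp only [wordStepF, ok_or, ok_and, ok_childF, ok_ex, ok_labF, ok_eq]
    exact ⟨⟨by simp, ok_dataMemF (by simp) le_rfl⟩, by simp, by simp,
      ih.mono (by intro i; simp; tauto) le_rfl⟩

/-- The sentence for `IsComputation.root`. -/
noncomputable def rootS : FOFormula (treeSig numLab) :=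
  .ex 0 (.and (labF .cfg 0) (.and (labF (.mark .same) 0) (dataMemF acc 0 1)))

/-- The sentence for `IsComputation.data` and `IsComputation.child`. -/
noncomputable def nodeS (d : ℕ) : FOFormula (treeSig numLab) :=
  .neg (.ex 0 (.and (labF .cfg 0) (.neg (.and (someDataF d 0 1)
    (.and (.or (labF (.zero false) 0) (childF false 0 1 (labF (.mark .dec) 1)))
      (.or (labF (.zero true) 0) (childF true 0 1 (labF (.mark .dec) 1))))))))

/-- See `RuleBad`. -/
noncomputable def ruleBadF : FOFormula (treeSig numLab) :=
  orF botF ((List.finRange (d + 1)).map fun e₁ : Fin (d + 1) =>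
    orF botF ((List.finRange (d + 1)).map fun e₂ : Fin (d + 1) =>
      .and (dataMemF {F e₁ e₂}ᶜ 0 1)
        (.and (childF false 0 1 (dataF e₁ 1 2)) (childF true 0 1 (dataF e₂ 1 2)))))

/-- See `BorderBad`. -/
noncomputable def borderBadF : FOFormula (treeSig numLab) :=
  .and (labF (.zero true) 0) (.and (childF false 0 1 (.eq 1 1)) (dataMemF {β}ᶜ 0 1))

/-- The sentence for `IsComputation.rule` and `IsComputation.border`. -/
noncomputable def ruleS : FOFormula (treeSig numLab) :=
  .neg (.ex 0 (.and (labF .cfg 0) (.or (ruleBadF F) (borderBadF β))))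

/-- The sentence for `IsComputation.counter`. -/
noncomputable def counterS : FOFormula (treeSig numLab) :=
  .neg (.ex 0 (.ex 1 (.and (labF .cfg 0) (.and (labF .cfg 1) (.ex 2 (.and (.eq 2 0)
    (.ex 3 (.and (.eq 3 1) (descendF^[k] counterBadF)))))))))

/-- The sentence for `IsComputation.tree`. -/
noncomputable def treeS : FOFormula (treeSig numLab) :=
  .neg (.ex 0 (.and (labF .cfg 0) (treeStepF^[k] (.neg leafOKF))))

/-- The sentence for `IsComputation.word`. -/
noncomputable def wordS (word : List (Fin (d + 1))) : FOFormula (treeSig numLab) :=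
  .neg (.ex 0 (.and (labF .cfg 0) (.and (labF (.zero false) 0) (.ex 1 (.and (.eq 1 0)
    (wordBadF β word))))))

/-- The sentence expressing `IsComputation`. -/
noncomputable def computationS (word : List (Fin (d + 1))) : FOFormula (treeSig numLab) :=
  .and (rootS acc) (.and (nodeS d) (.and (ruleS F β)
    (.and (counterS k) (.and (treeS k) (wordS β word)))))

/-- Each universal condition is the negation of an existential sentence. Below that, only formulas
in at most one variable are negated, and these are free of negation themselves. -/
theorem ok_computationS (word : List (Fin (d + 1))) : (computationS F β acc k word).Ok ∅ 2 := by
  have h01 : (insert 0 (∅ : Finset ℕ)) = {0} := rfl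
  simp only [computationS, ok_and]
  refine ⟨?_, ?_, ?_, ?_, ?_, ?_⟩
  · simp only [rootS, ok_ex, ok_and, ok_labF]
    exact ⟨by simp, by simp, ok_dataMemF (by simp) (by norm_num)⟩
  · refine Ok.neg_closed ?_
    rw [ok_ex, ok_and]
    refine ⟨by simp, Ok.neg ?_⟩
    simp only [ok_and, ok_or, ok_childF, ok_labF]
    exact ⟨ok_someDataF (by simp), by simp, by simp⟩
  · refine Ok.neg_closed ?_
    rw [ok_ex, ok_and, ok_or]
    refine ⟨by simp, ok_orF (ok_botF le_rfl) fun ψ hψ => ?_, ?_⟩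
    · obtain ⟨e₁, -, rfl⟩ := List.mem_map.1 hψ
      refine ok_orF (ok_botF le_rfl) fun χ hχ => ?_
      obtain ⟨e₂, -, rfl⟩ := List.mem_map.1 hχ
      simp only [ok_and, ok_childF]
      exact ⟨ok_dataMemF (by simp) le_rfl, ⟨by simp, ok_dataF (by simp)⟩,
        by simp, ok_dataF (by simp)⟩
    · simp only [borderBadF, ok_and, ok_childF, ok_labF, ok_eq]
      exact ⟨by simp, ⟨by simp, by simp⟩, ok_dataMemF (by simp) le_rfl⟩
  · refine Ok.mono (n := 1) (Ok.neg_closed ?_) subset_rfl (by norm_num)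
    simp only [ok_ex, ok_and, ok_labF, ok_eq]
    refine ⟨by simp, by simp, by simp, by simp, (ok_descendF k).mono (by intro i; simp; tauto) le_rfl⟩
  · refine Ok.neg_closed ?_
    simp only [ok_ex, ok_and, ok_labF]
    exact ⟨by simp, ok_treeStepF k⟩
  · refine Ok.neg_closed ?_
    simp only [ok_ex, ok_and, ok_labF, ok_eq]
    exact ⟨by simp, by simp, by simp, (ok_wordBadF β word).mono (by intro i; simp; tauto) le_rfl⟩

theorem negDepth_computationS (word : List (Fin (d + 1))) :
    (computationS F β acc k word).negDepth = 2 := by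
  refine le_antisymm (ok_computationS F β acc k word).2.2 ?_
  -- The conjunct requiring data and children always attains depth `2`, so the depth is exact for
  -- all parameters.
  have : 2 ≤ (nodeS d).negDepth := by
    simp only [nodeS, negDepth]
    omega
  simp only [computationS, negDepth]
  omega

end Automaton

end FOFormula

/-! ### Semantics and encoding of the formulas. -/

namespace FOFormula

section Realize

variable {M : Type} [S : (treeSig numLab).Structure M] {v : ℕ → M}

@[simp] theorem realize_edgeF {x y : ℕ} : (edgeF x y).Realize v ↔ IsChild S (v x) (v y) := by
  have : (fun i => v (![x, y] i)) = ![v x, v y] := by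
    funext i
    fin_cases i <;> rfl
  simp only [edgeF, Realize, IsChild, this]

@[simp] theorem realize_labF {l : Lab} {x : ℕ} : (labF l x).Realize v ↔ HasLabel S l (v x) := by
  have : (fun i => v (![x] i)) = ![v x] := by
    funext i
    fin_cases i
    rfl
  simp only [labF, Realize, HasLabel, this]

theorem realize_orF {φ : FOFormula (treeSig numLab)} {l : List (FOFormula (treeSig numLab))} :
    (orF φ l).Realize v ↔ φ.Realize v ∨ ∃ ψ ∈ l, ψ.Realize v := by
  induction l with
  | nil => simp [orF]
  | cons ψ l ih =>
    rw [orF, List.foldr_cons, ← orF, Realize, ih, List.exists_mem_cons_iff]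
    tauto

@[simp] theorem realize_botF : ¬ (botF : FOFormula (treeSig numLab)).Realize v := by
  simp [botF, Realize]

/-- The two variables exchange their roles at every edge of the path, so they have to be distinct.
-/
theorem realize_dataF {e x y : ℕ} (hxy : x ≠ y) :
    (dataF e x y).Realize v ↔ DataAt (IsChild S) (HasLabel S) e (v x) := by
  induction e generalizing x y v with
  | zero => simp [dataF, DataAt]
  | succ e ih => simp [dataF, DataAt, Realize, ih hxy.symm, hxy]

theorem realize_someDataF {d x y : ℕ} (hxy : x ≠ y) : (someDataF d x y).Realize v ↔
    ∃ e : Fin (d + 1), DataAt (IsChild S) (HasLabel S) e (v x) := by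
  simp only [someDataF, realize_orF, List.mem_map, List.mem_finRange, true_and, exists_exists_eq_and,
    realize_dataF hxy]
  exact ⟨fun h => h.elim (fun h => ⟨0, h⟩) id, .inr⟩

theorem realize_dataMemF {d x y : ℕ} (hxy : x ≠ y) {A : Set (Fin (d + 1))} :
    (dataMemF A x y).Realize v ↔ ∃ e ∈ A, DataAt (IsChild S) (HasLabel S) e (v x) := by
  simp [dataMemF, realize_orF, realize_dataF hxy]

theorem realize_dataMemF_compl {d x y : ℕ} (hxy : x ≠ y) {e : Fin (d + 1)} :
    (dataMemF {e}ᶜ x y).Realize v ↔ DataNe (IsChild S) (HasLabel S) e (v x) := by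
  simp [realize_dataMemF hxy, DataNe]

theorem realize_childF {c : Bool} {x y : ℕ} (hxy : x ≠ y) {φ : FOFormula (treeSig numLab)} :
    (childF c x y φ).Realize v ↔ HasChild (IsChild S) (HasLabel S) c
      (fun a => φ.Realize (Function.update v y a)) (v x) := by
  simp [childF, HasChild, Realize, hxy]

theorem realize_sideF {b : Bool} {m : Mark} :
    (sideF b m).Realize v ↔ HasSide (IsChild S) (HasLabel S) b m (v 0) := by
  simp [sideF, HasSide, Realize]

theorem realize_markOKF {m : Mark} :
    (markOKF m).Realize v ↔ MarkOK (IsChild S) (HasLabel S) m (v 0) := by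
  cases m <;> simp [markOKF, MarkOK, Realize, realize_sideF]

theorem realize_markBadF {m : Mark} : (markBadF m).Realize v ↔
    HasLabel S (.mark m) (v 0) ∧ ¬ MarkOK (IsChild S) (HasLabel S) m (v 0) := by
  simp [markBadF, Realize, realize_markOKF]

theorem realize_treeStepF {k : ℕ} : (treeStepF^[k] (.neg leafOKF)).Realize v ↔
    ¬ TreeOK (IsChild S) (HasLabel S) k (v 0) := by
  induction k generalizing v with
  | zero => simp [leafOKF, TreeOK, LeafOK, Realize]
  | succ k ih =>
    rw [Function.iterate_succ_apply', TreeOK, not_and_or]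
    simp only [treeStepF, Realize, ih, realize_markBadF, realize_edgeF, realize_labF]
    refine or_congr ?_ ?_
    · rw [not_forall]
      constructor
      · rintro (h | h | h) <;> exact ⟨_, fun h' => h.2 (h' h.1)⟩
      · rintro ⟨m, h⟩
        rw [Classical.not_imp] at h
        cases m
        · exact .inl h
        · exact .inr (.inl h)
        · exact .inr (.inr h)
    · simp only [not_forall, exists_prop]
      refine exists_congr fun y => ?_
      simp

theorem realize_sameBadF {c : Bool} :
    (sameBadF c).Realize v ↔ SameBad (HasLabel S) c (v 2) (v 3) := by
  simp [sameBadF, SameBad, Realize]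

theorem realize_decBadF {c : Bool} :
    (decBadF c).Realize v ↔ DecBad (HasLabel S) c (v 2) (v 3) := by
  simp [decBadF, DecBad, Realize, realize_sameBadF]

theorem realize_counterBadF : counterBadF.Realize v ↔
    CounterBad (IsChild S) (HasLabel S) (v 0) (v 1) (v 2) (v 3) := by
  simp only [counterBadF, selfBadF, childBadF, CounterBad, Realize, realize_sameBadF,
    realize_decBadF, realize_edgeF, realize_labF, Bool.exists_bool]

/-- Each level contributes one letter of the common address: variables `4` and `5` name the next
nodes and are copied back to `2` and `3`, while `0` and `1` keep the starting nodes. -/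
theorem realize_descendF {k : ℕ} : (descendF^[k] counterBadF).Realize v ↔
    ∃ a : List Bool, a.length = k ∧ ∃ z z', AddrWalk (IsChild S) (HasLabel S) a (v 2) z ∧
      AddrWalk (IsChild S) (HasLabel S) a (v 3) z' ∧
      CounterBad (IsChild S) (HasLabel S) (v 0) (v 1) z z' := by
  induction k generalizing v with
  | zero =>
    simp only [Function.iterate_zero, id_eq, realize_counterBadF, List.length_eq_zero_iff]
    constructor
    · exact fun h => ⟨[], rfl, _, _, rfl, rfl, h⟩
    · rintro ⟨_, rfl, z, z', hz, hz', h⟩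
      cases hz
      cases hz'
      exact h
  | succ k ih =>
    rw [Function.iterate_succ_apply']
    simp only [descendF, Realize, ih, realize_edgeF, realize_labF]
    simp only [ne_eq, Nat.reduceEqDiff, not_false_eq_true, Function.update_self,
      Function.update_of_ne, OfNat.zero_ne_ofNat, OfNat.one_ne_ofNat, exists_eq_left]
    constructor
    · rintro ⟨y, hy, y', hy', hb, a, ha, z, z', hz, hz', h⟩
      rcases hb with hb | hb
      · exact ⟨false :: a, by simp [ha], z, z', ⟨y, hy, hb.1, hz⟩, ⟨y', hy', hb.2, hz'⟩, h⟩
      · exact ⟨true :: a, by simp [ha], z, z', ⟨y, hy, hb.1, hz⟩, ⟨y', hy', hb.2, hz'⟩, h⟩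
    · rintro ⟨_ | ⟨b, a⟩, ha, z, z', hz, hz', h⟩
      · cases ha
      · obtain ⟨y, hy, hb, hz⟩ := hz
        obtain ⟨y', hy', hb', hz'⟩ := hz'
        refine ⟨y, hy, y', hy', ?_, a, by simpa using ha, z, z', hz, hz', h⟩
        cases b
        · exact .inl ⟨hb, hb'⟩
        · exact .inr ⟨hb, hb'⟩

section Automaton

variable {d : ℕ} {F : Fin (d + 1) → Fin (d + 1) → Fin (d + 1)} {β : Fin (d + 1)}
  {acc : Set (Fin (d + 1))} {k : ℕ} {word : List (Fin (d + 1))}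

theorem realize_wordBadF : (wordBadF β word).Realize v ↔
    WordBad (IsChild S) (HasLabel S) β word (v 0) (v 1) := by
  induction word generalizing v with
  | nil => exact realize_dataMemF_compl (by norm_num)
  | cons e word ih =>
    change (wordStepF e (wordBadF β word)).Realize v ↔ _
    simp only [wordStepF, Realize, realize_childF (show 1 ≠ 2 by norm_num), ih, realize_labF,
      realize_dataMemF_compl (show 0 ≠ 2 by norm_num), WordBad]
    simp

theorem realize_ruleBadF : (ruleBadF F).Realize v ↔
    RuleBad (IsChild S) (HasLabel S) F (v 0) := by
  simp only [ruleBadF, realize_orF, realize_botF, false_or, List.mem_map, List.mem_finRange,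
    true_and, exists_exists_eq_and, Realize, realize_dataMemF_compl (show 0 ≠ 1 by norm_num),
    realize_childF (show 0 ≠ 1 by norm_num), realize_dataF (show 1 ≠ 2 by norm_num),
    Function.update_self, RuleBad, DataNe]
  constructor
  · rintro ⟨e₁, e₂, ⟨e, h1, h2⟩, h3⟩
    exact ⟨e, e₁, e₂, h1, h2, h3⟩
  · rintro ⟨e, e₁, e₂, h1, h2, h3⟩
    exact ⟨e₁, e₂, ⟨e, h1, h2⟩, h3⟩

theorem realize_borderBadF : (borderBadF β).Realize v ↔
    BorderBad (IsChild S) (HasLabel S) β (v 0) := by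
  simp [borderBadF, Realize, realize_dataMemF_compl (show 0 ≠ 1 by norm_num),
    realize_childF (show 0 ≠ 1 by norm_num), BorderBad]

theorem realize_computationS : (computationS F β acc k word).Realize v ↔
    IsComputation (IsChild S) (HasLabel S) k F β word acc := by
  have hroot : (rootS acc).Realize v ↔ ∃ x, HasLabel S .cfg x ∧ HasLabel S (.mark .same) x ∧
      ∃ e ∈ acc, DataAt (IsChild S) (HasLabel S) e x := by
    simp [rootS, Realize, realize_dataMemF (show 0 ≠ 1 by norm_num)]
  have hnode : (nodeS d).Realize v ↔ ∀ x, HasLabel S .cfg x →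
      (∃ e : Fin (d + 1), DataAt (IsChild S) (HasLabel S) e x) ∧
      ∀ c, HasLabel S (.zero c) x ∨
        HasChild (IsChild S) (HasLabel S) c (HasLabel S (.mark .dec)) x := by
    simp only [nodeS, Realize, realize_labF, realize_someDataF (show 0 ≠ 1 by norm_num),
      realize_childF (show 0 ≠ 1 by norm_num), Function.update_self, not_exists, Bool.forall_bool]
    exact forall_congr' fun x => by
      rw [not_and, Classical.not_not]
  have hrule : (ruleS F β).Realize v ↔ ∀ x, HasLabel S .cfg x →
      ¬ RuleBad (IsChild S) (HasLabel S) F x ∧ ¬ BorderBad (IsChild S) (HasLabel S) β x := by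
    simp only [ruleS, Realize, realize_labF, realize_ruleBadF, realize_borderBadF,
      Function.update_self, not_exists, not_and, not_or]
  have hcounter : (counterS k).Realize v ↔ ∀ x y, HasLabel S .cfg x → HasLabel S .cfg y →
      ∀ a : List Bool, a.length = k → ∀ z z', AddrWalk (IsChild S) (HasLabel S) a x z →
        AddrWalk (IsChild S) (HasLabel S) a y z' →
        ¬ CounterBad (IsChild S) (HasLabel S) x y z z' := by
    simp [counterS, Realize, realize_descendF]
    constructor
    · exact fun h x y hx hy a ha z z' hz hz' => h x hx y hy a ha z hz z' hz'
    · exact fun h x hx y hy a ha z hz z' hz' => h x y hx hy a ha z z' hz hz'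
  have htree : (treeS k).Realize v ↔ ∀ x, HasLabel S .cfg x →
      TreeOK (IsChild S) (HasLabel S) k x := by
    simp [treeS, Realize, realize_treeStepF]
  have hword : (wordS β word).Realize v ↔ ∀ x, HasLabel S .cfg x → HasLabel S (.zero false) x →
      ¬ WordBad (IsChild S) (HasLabel S) β word x x := by
    simp [wordS, Realize, realize_wordBadF]
  simp only [computationS, Realize, hroot, hnode, hrule, hcounter, htree, hword]
  constructor
  · rintro ⟨h1, h2, h3, h4, h5, h6⟩
    exact ⟨h1, fun x hx => (h2 x hx).1, fun x hx => (h2 x hx).2, fun x hx => (h3 x hx).1,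
      fun x hx => (h3 x hx).2, h4, h5, h6⟩
  · rintro ⟨h1, h2, h3, h4, h5, h6, h7, h8⟩
    exact ⟨h1, fun x hx => ⟨h2 x hx, h3 x hx⟩, fun x hx => ⟨h4 x hx, h5 x hx⟩, h6, h7, h8⟩

end Automaton

end Realize

/-! ### The sentences as strings -/

section Encode

variable {σ : FirstOrder.Language.{0, 0}}

/-- The function `f` adds the prefix `s` to the string of a formula. -/
def HasPrefix (f : FOFormula σ → FOFormula σ) (s : List (Token σ)) : Prop :=
  ∀ φ, (f φ).encode = s ++ φ.encode

theorem hasPrefix_and (ψ : FOFormula σ) : HasPrefix (FOFormula.and ψ) (Token.and :: ψ.encode) :=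
  fun _ => by simp [encode]

theorem hasPrefix_or (ψ : FOFormula σ) : HasPrefix (FOFormula.or ψ) (Token.or :: ψ.encode) :=
  fun _ => by simp [encode]

theorem hasPrefix_ex (x : ℕ) :
    HasPrefix (FOFormula.ex x : FOFormula σ → FOFormula σ) (Token.ex :: encodeVar σ x) :=
  fun _ => by simp [encode]

theorem hasPrefix_neg : HasPrefix (FOFormula.neg : FOFormula σ → FOFormula σ) [Token.neg] :=
  fun _ => by simp [encode]

theorem HasPrefix.comp {f g : FOFormula σ → FOFormula σ} {s t : List (Token σ)}
    (hf : HasPrefix f s) (hg : HasPrefix g t) : HasPrefix (fun φ => f (g φ)) (s ++ t) :=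
  fun φ => by rw [hf, hg, List.append_assoc]

theorem HasPrefix.iterate {f : FOFormula σ → FOFormula σ} {s : List (Token σ)}
    (hf : HasPrefix f s) (k : ℕ) : HasPrefix f^[k] (List.replicate k s).flatten := by
  induction k with
  | zero => intro φ; simp
  | succ k ih =>
    intro φ
    rw [Function.iterate_succ_apply', hf, ih, List.replicate_succ, List.flatten_cons,
      List.append_assoc]

/-- The argument occurs once, at the very end in prefix notation, and reusing variables makes all
levels alike. Iterating therefore repeats one block. -/
theorem exists_hasPrefix_descendF : ∃ s, HasPrefix descendF s :=
  ⟨_, (hasPrefix_ex 4).comp <| (hasPrefix_and _).comp <| (hasPrefix_ex 5).comp <|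
    (hasPrefix_and _).comp <| (hasPrefix_and _).comp <| (hasPrefix_ex 2).comp <|
    (hasPrefix_and _).comp <| (hasPrefix_ex 3).comp <| hasPrefix_and _⟩

theorem exists_hasPrefix_treeStepF : ∃ s, HasPrefix treeStepF s :=
  ⟨_, (hasPrefix_or _).comp <| (hasPrefix_ex 1).comp <| (hasPrefix_and _).comp <|
    (hasPrefix_and _).comp <| (hasPrefix_ex 0).comp <| hasPrefix_and _⟩

theorem exists_hasPrefix_wordStepF {d : ℕ} (e : Fin (d + 1)) : ∃ s, HasPrefix (wordStepF e) s :=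
  ⟨_, (hasPrefix_or _).comp <| (hasPrefix_ex 2).comp <| (hasPrefix_and _).comp <|
    (hasPrefix_and _).comp <| (hasPrefix_and _).comp <| (hasPrefix_ex 1).comp <| hasPrefix_and _⟩

/-- The string of the sentence expressing `IsComputation` consists of two fixed blocks that are
repeated according to the depth of the address trees, of a block for each letter of the word, and of
fixed strings between these parts. -/
theorem exists_encode_computationS {d : ℕ} (F : Fin (d + 1) → Fin (d + 1) → Fin (d + 1))
    (β : Fin (d + 1)) (acc : Set (Fin (d + 1))) :
    ∃ (c₀ c₁ c₂ c₃ b₁ b₂ : List (Token (treeSig numLab)))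
      (b₃ : Fin (d + 1) → List (Token (treeSig numLab))),
      ∀ k word, (computationS F β acc k word).encode =
        c₀ ++ (List.replicate k b₁).flatten ++ c₁ ++ (List.replicate k b₂).flatten ++ c₂ ++
          word.flatMap b₃ ++ c₃ := by
  obtain ⟨b₁, hb₁⟩ := exists_hasPrefix_descendF
  obtain ⟨b₂, hb₂⟩ := exists_hasPrefix_treeStepF
  choose b₃ hb₃ using exists_hasPrefix_wordStepF (d := d)
  have h₀ : ∃ s, HasPrefix (fun φ => .and (rootS acc) (.and (nodeS d) (.and (ruleS F β) φ))) s :=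
    ⟨_, (hasPrefix_and _).comp <| (hasPrefix_and _).comp <| hasPrefix_and _⟩
  have h₁ : ∃ s, HasPrefix (fun φ : FOFormula (treeSig numLab) => .neg (.ex 0 (.ex 1
      (.and (labF .cfg 0) (.and (labF .cfg 1) (.ex 2 (.and (.eq 2 0)
        (.ex 3 (.and (.eq 3 1) φ))))))))) s :=
    ⟨_, hasPrefix_neg.comp <| (hasPrefix_ex _).comp <| (hasPrefix_ex _).comp <|
      (hasPrefix_and _).comp <| (hasPrefix_and _).comp <| (hasPrefix_ex _).comp <|
      (hasPrefix_and _).comp <| (hasPrefix_ex _).comp <| hasPrefix_and _⟩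
  have h₂ : ∃ s, HasPrefix (fun φ : FOFormula (treeSig numLab) => .neg (.ex 0
      (.and (labF .cfg 0) φ))) s :=
    ⟨_, hasPrefix_neg.comp <| (hasPrefix_ex _).comp <| hasPrefix_and _⟩
  have h₃ : ∃ s, HasPrefix (fun φ : FOFormula (treeSig numLab) => .neg (.ex 0
      (.and (labF .cfg 0) (.and (labF (.zero false) 0) (.ex 1 (.and (.eq 1 0) φ)))))) s :=
    ⟨_, hasPrefix_neg.comp <| (hasPrefix_ex _).comp <| (hasPrefix_and _).comp <|
      (hasPrefix_and _).comp <| (hasPrefix_ex _).comp <| hasPrefix_and _⟩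
  obtain ⟨s₀, h₀⟩ := h₀
  obtain ⟨s₁, h₁⟩ := h₁
  obtain ⟨s₂, h₂⟩ := h₂
  obtain ⟨s₃, h₃⟩ := h₃
  have hword : ∀ word, (wordBadF β word).encode =
      word.flatMap b₃ ++ (wordBadF β []).encode := fun word => by
    induction word with
    | nil => simp
    | cons e word ih =>
      change (wordStepF e (wordBadF β word)).encode = _
      rw [hb₃, ih, List.flatMap_cons, List.append_assoc]
  refine ⟨s₀ ++ Token.and :: s₁, counterBadF.encode ++ Token.and :: s₂,
    (FOFormula.neg leafOKF).encode ++ s₃, (wordBadF β []).encode, b₁, b₂, b₃, fun k word => ?_⟩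
  have e₁ : (counterS k).encode = s₁ ++ (descendF^[k] counterBadF).encode := h₁ _
  have e₂ : (treeS k).encode = s₂ ++ (treeStepF^[k] (.neg leafOKF)).encode := h₂ _
  have e₃ : (wordS β word).encode = s₃ ++ (wordBadF β word).encode := h₃ _
  have e₀ : (computationS F β acc k word).encode = s₀ ++
    (FOFormula.and (counterS k) (.and (treeS k) (wordS β word))).encode := h₀ _
  rw [e₀, encode, encode, e₁, e₂, e₃, hword, hb₁.iterate, hb₂.iterate]
  simp only [List.append_assoc, List.cons_append]

end Encode

end FOFormula

/-! ### A stack machine printing strings with repeated blocks -/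

namespace BlockPrinter

open Turing

/-- The stacks: input, reversed input, two copies of the length, the factor of the power, a copy
of it, the product, the exponent, and the output. -/
inductive Stack
  | inp | rev | len | len' | fac | fac' | prod | expo | out
  deriving DecidableEq

noncomputable instance : Fintype Stack :=
  have : Finite Stack := Finite.of_surjective (fun i : Fin 9 =>
    ![Stack.inp, .rev, .len, .len', .fac, .fac', .prod, .expo, .out] i) fun k => by
      cases k
      exacts [⟨0, rfl⟩, ⟨1, rfl⟩, ⟨2, rfl⟩, ⟨3, rfl⟩, ⟨4, rfl⟩, ⟨5, rfl⟩, ⟨6, rfl⟩, ⟨7, rfl⟩, ⟨8, rfl⟩]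
  Fintype.ofFinite _

/-- The program points. -/
inductive Label (A : Type)
  | read | write | emit (a : A) | power | outer | inner | restoreFac | restoreLen | clearFac
  | moveProd | second | first | clearLen

instance {A : Type} [Finite A] : Finite (Label A) :=
  Finite.of_surjective (fun i : Fin 12 ⊕ A => match i with
    | .inl i => ![Label.read, .write, .power, .outer, .inner, .restoreFac, .restoreLen, .clearFac,
      .moveProd, .second, .first, .clearLen] i
    | .inr a => .emit a) fun l => by
      cases l
      case emit a => exact ⟨.inr a, rfl⟩
      exacts [⟨.inl 0, rfl⟩, ⟨.inl 1, rfl⟩, ⟨.inl 2, rfl⟩, ⟨.inl 3, rfl⟩, ⟨.inl 4, rfl⟩,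
        ⟨.inl 5, rfl⟩, ⟨.inl 6, rfl⟩, ⟨.inl 7, rfl⟩, ⟨.inl 8, rfl⟩, ⟨.inl 9, rfl⟩, ⟨.inl 10, rfl⟩,
        ⟨.inl 11, rfl⟩]

variable {A B : Type}

/-- The stack alphabets. -/
abbrev Symb (A B : Type) : Stack → Type
  | .inp => A
  | .out => B
  | _ => Option A

/-- The statements of the machine. -/
abbrev Code (A B : Type) : Type := TM2.Stmt (Symb A B) (Label A) (Option (Option A))

/-- Push a constant string. -/
def pushAll (k : Stack) : List (Symb A B k) → Code A B → Code A B
  | [], q => q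
  | a :: l, q => pushAll k l (.push k (fun _ => a) q)

/-- The last letter is pushed first, so the string lies on the stack in reading order. Outputs are
accordingly produced from back to front. -/
theorem stepAux_pushAll (k : Stack) (l : List (Symb A B k)) (q : Code A B)
    (v : Option (Option A)) (S : ∀ k, List (Symb A B k)) :
    TM2.stepAux (pushAll k l q) v S = TM2.stepAux q v (Function.update S k (l ++ S k)) := by
  induction l generalizing q with
  | nil => simp [pushAll]
  | cons a l ih => rw [pushAll, ih, TM2.stepAux]; simp

/-- Continue at a program point. -/
def jump (l : Label A) : Code A B := .goto fun _ => l

/-- Branch on whether a symbol has been popped. -/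
def ifSome (q₁ q₂ : Code A B) : Code A B := .branch (fun v => v.isSome) q₁ q₂

variable (s d : ℕ) (c₀ c₁ c₂ c₃ b₁ b₂ : List B) (b₃ : A → List B)

/-- The program. -/
def program : Label A → Code A B
  | .read => .pop .inp (fun _ x => x.map some) <| ifSome
      (.push .rev (fun v => v.getD none) <| .push .len (fun _ => none) <| jump .read)
      (pushAll .len (List.replicate s none) <| pushAll .out c₃ <| pushAll .fac [none] <|
        pushAll .expo (List.replicate d none) <| jump .write)
  | .write => .pop .rev (fun _ x => x) <| ifSome
      (.goto fun v => match v with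
        | some (some a) => .emit a
        | _ => .write)
      (pushAll .out c₂ <| jump .power)
  | .emit a => pushAll .out (b₃ a) <| jump .write
  | .power => .pop .expo (fun _ x => x) <| ifSome (jump .outer) (jump .second)
  | .outer => .pop .len (fun _ x => x) <| ifSome
      (.push .len' (fun _ => none) <| jump .inner) (jump .restoreLen)
  | .inner => .pop .fac (fun _ x => x) <| ifSome
      (.push .fac' (fun _ => none) <| .push .prod (fun _ => none) <| jump .inner) (jump .restoreFac)
  | .restoreFac => .pop .fac' (fun _ x => x) <| ifSome
      (.push .fac (fun _ => none) <| jump .restoreFac) (jump .outer)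
  | .restoreLen => .pop .len' (fun _ x => x) <| ifSome
      (.push .len (fun _ => none) <| jump .restoreLen) (jump .clearFac)
  | .clearFac => .pop .fac (fun _ x => x) <| ifSome (jump .clearFac) (jump .moveProd)
  | .moveProd => .pop .prod (fun _ x => x) <| ifSome
      (.push .fac (fun _ => none) <| jump .moveProd) (jump .power)
  | .second => .pop .fac (fun _ x => x) <| ifSome
      (.push .fac' (fun _ => none) <| pushAll .out b₂ <| jump .second)
      (pushAll .out c₁ <| jump .first)
  | .first => .pop .fac' (fun _ x => x) <| ifSome
      (pushAll .out b₁ <| jump .first) (pushAll .out c₀ <| jump .clearLen)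
  | .clearLen => .pop .len (fun _ x => x) <| ifSome (jump .clearLen) .halt

/-- The contents of the stacks; those of the unary ones are given by numbers. -/
def conts (inp rev : List A) (len len' fac fac' prod expo : ℕ) (out : List B) :
    ∀ k, List (Symb A B k)
  | .inp => inp
  | .rev => rev.map some
  | .len => List.replicate len none
  | .len' => List.replicate len' none
  | .fac => List.replicate fac none
  | .fac' => List.replicate fac' none
  | .prod => List.replicate prod none
  | .expo => List.replicate expo none
  | .out => out

/-- The step function. -/
def stepFn : TM2.Cfg (Symb A B) (Label A) (Option (Option A)) →
    Option (TM2.Cfg (Symb A B) (Label A) (Option (Option A))) :=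
  TM2.step (program s d c₀ c₁ c₂ c₃ b₁ b₂ b₃)

/-- The machine goes from one program point and stack contents to others in `t` steps. -/
def Run (t : ℕ) (l : Label A) (S : ∀ k, List (Symb A B k)) (l' : Label A)
    (S' : ∀ k, List (Symb A B k)) : Prop :=
  ∀ v, ∃ v', (flip bind (stepFn s d c₀ c₁ c₂ c₃ b₁ b₂ b₃))^[t] (some ⟨some l, v, S⟩) =
    some ⟨some l', v', S'⟩

variable {s d c₀ c₁ c₂ c₃ b₁ b₂ b₃}

theorem Run.trans {t t' : ℕ} {l l' l'' : Label A} {S S' S'' : ∀ k, List (Symb A B k)}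
    (h : Run s d c₀ c₁ c₂ c₃ b₁ b₂ b₃ t l S l' S')
    (h' : Run s d c₀ c₁ c₂ c₃ b₁ b₂ b₃ t' l' S' l'' S'') :
    Run s d c₀ c₁ c₂ c₃ b₁ b₂ b₃ (t + t') l S l'' S'' := fun v => by
  obtain ⟨v', hv'⟩ := h v
  obtain ⟨v'', hv''⟩ := h' v'
  exact ⟨v'', by rw [add_comm, Function.iterate_add_apply, hv', hv'']⟩

theorem Run.single {l l' : Label A} {S S' : ∀ k, List (Symb A B k)}
    (h : ∀ v, ∃ v', TM2.stepAux (program s d c₀ c₁ c₂ c₃ b₁ b₂ b₃ l) v S = ⟨some l', v', S'⟩) :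
    Run s d c₀ c₁ c₂ c₃ b₁ b₂ b₃ 1 l S l' S' := fun v => by
  obtain ⟨v', hv'⟩ := h v
  exact ⟨v', congrArg some hv'⟩

theorem cfg_eq {Γ : Stack → Type} {Λ σ : Type} {l : Option Λ} {v : σ} {S S' : ∀ k, List (Γ k)}
    (h : ∀ k, S k = S' k) : (⟨l, v, S⟩ : TM2.Cfg Γ Λ σ) = ⟨l, v, S'⟩ := by
  rw [funext h]

section Loops

variable (inp rev : List A) (len len' fac fac' prod expo : ℕ) (out : List B)

theorem run_inner : Run s d c₀ c₁ c₂ c₃ b₁ b₂ b₃ (fac + 1)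
    .inner (conts inp rev len len' fac fac' prod expo out)
    .restoreFac (conts inp rev len len' 0 (fac' + fac) (prod + fac) expo out) := by
  induction fac generalizing fac' prod with
  | zero => exact Run.single fun v => ⟨none, cfg_eq fun k => by cases k <;> rfl⟩
  | succ fac ih =>
    have := ih (fac' + 1) (prod + 1)
    rw [Nat.add_right_comm, Nat.add_right_comm prod] at this
    rw [Nat.add_comm (fac + 1) 1]
    exact Run.trans (Run.single fun v => ⟨some none, cfg_eq fun k => by cases k <;> rfl⟩) this

theorem run_restoreFac : Run s d c₀ c₁ c₂ c₃ b₁ b₂ b₃ (fac' + 1)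
    .restoreFac (conts inp rev len len' fac fac' prod expo out)
    .outer (conts inp rev len len' (fac + fac') 0 prod expo out) := by
  induction fac' generalizing fac with
  | zero => exact Run.single fun v => ⟨none, cfg_eq fun k => by cases k <;> rfl⟩
  | succ fac' ih =>
    have := ih (fac + 1)
    rw [Nat.add_right_comm fac] at this
    rw [Nat.add_comm (fac' + 1) 1]
    exact Run.trans (Run.single fun v => ⟨some none, cfg_eq fun k => by cases k <;> rfl⟩) this

/-- Multiplication by repeated addition: each unit of `len` adds `fac` to `prod` through the copy
`fac'`, at a cost of `1 + (fac + 1) + (fac + 1)` steps. -/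
theorem run_outer : Run s d c₀ c₁ c₂ c₃ b₁ b₂ b₃ (len * (2 * fac + 3) + 1)
    .outer (conts inp rev len len' fac 0 prod expo out)
    .restoreLen (conts inp rev 0 (len' + len) fac 0 (prod + len * fac) expo out) := by
  induction len generalizing len' prod with
  | zero =>
    rw [Nat.zero_mul, Nat.zero_mul]
    exact Run.single fun v => ⟨none, cfg_eq fun k => by cases k <;> rfl⟩
  | succ len ih =>
    have h1 : Run s d c₀ c₁ c₂ c₃ b₁ b₂ b₃ 1
        .outer (conts inp rev (len + 1) len' fac 0 prod expo out)
        .inner (conts inp rev len (len' + 1) fac 0 prod expo out) :=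
      Run.single fun v => ⟨some none, cfg_eq fun k => by cases k <;> rfl⟩
    have h2 := run_inner (s := s) (d := d) (c₀ := c₀) (c₁ := c₁) (c₂ := c₂) (c₃ := c₃) (b₁ := b₁)
      (b₂ := b₂) (b₃ := b₃) inp rev len (len' + 1) fac 0 prod expo out
    have h3 := run_restoreFac (s := s) (d := d) (c₀ := c₀) (c₁ := c₁) (c₂ := c₂) (c₃ := c₃)
      (b₁ := b₁) (b₂ := b₂) (b₃ := b₃) inp rev len (len' + 1) 0 (0 + fac) (prod + fac) expo out
    have h4 := ((h1.trans h2).trans h3).trans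
      (by rw [Nat.zero_add, Nat.zero_add]; exact ih (len' + 1) (prod + fac))
    rw [show (len + 1) * (2 * fac + 3) + 1 =
        1 + (fac + 1) + (0 + fac + 1) + (len * (2 * fac + 3) + 1) by ring,
      show len' + (len + 1) = len' + 1 + len by ring,
      show prod + (len + 1) * fac = prod + fac + len * fac by ring]
    exact h4

theorem run_restoreLen : Run s d c₀ c₁ c₂ c₃ b₁ b₂ b₃ (len' + 1)
    .restoreLen (conts inp rev len len' fac fac' prod expo out)
    .clearFac (conts inp rev (len + len') 0 fac fac' prod expo out) := by
  induction len' generalizing len with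
  | zero => exact Run.single fun v => ⟨none, cfg_eq fun k => by cases k <;> rfl⟩
  | succ len' ih =>
    have := ih (len + 1)
    rw [Nat.add_right_comm len] at this
    rw [Nat.add_comm (len' + 1) 1]
    exact Run.trans (Run.single fun v => ⟨some none, cfg_eq fun k => by cases k <;> rfl⟩) this

theorem run_clearFac : Run s d c₀ c₁ c₂ c₃ b₁ b₂ b₃ (fac + 1)
    .clearFac (conts inp rev len len' fac fac' prod expo out)
    .moveProd (conts inp rev len len' 0 fac' prod expo out) := by
  induction fac with
  | zero => exact Run.single fun v => ⟨none, cfg_eq fun k => by cases k <;> rfl⟩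
  | succ fac ih =>
    rw [Nat.add_comm (fac + 1) 1]
    exact Run.trans (Run.single fun v => ⟨some none, cfg_eq fun k => by cases k <;> rfl⟩) ih

theorem run_moveProd : Run s d c₀ c₁ c₂ c₃ b₁ b₂ b₃ (prod + 1)
    .moveProd (conts inp rev len len' fac fac' prod expo out)
    .power (conts inp rev len len' (fac + prod) fac' 0 expo out) := by
  induction prod generalizing fac with
  | zero => exact Run.single fun v => ⟨none, cfg_eq fun k => by cases k <;> rfl⟩
  | succ prod ih =>
    have := ih (fac + 1)
    rw [Nat.add_right_comm fac] at this
    rw [Nat.add_comm (prod + 1) 1]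
    exact Run.trans (Run.single fun v => ⟨some none, cfg_eq fun k => by cases k <;> rfl⟩) this

end Loops

/-- The number of steps for multiplying `x` with the `e`-th power of `n`. -/
def powerCost {K : Type*} [Semiring K] (n : K) : ℕ → K → K
  | 0, _ => 1
  | e + 1, x => 1 + (n * (2 * x + 3) + 1) + (n + 1) + (x + 1) + (n * x + 1) + powerCost n e (n * x)

theorem run_power (inp rev : List A) (len fac expo : ℕ) (out : List B) :
    Run s d c₀ c₁ c₂ c₃ b₁ b₂ b₃ (powerCost len expo fac)
      .power (conts inp rev len 0 fac 0 0 expo out)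
      .second (conts inp rev len 0 (len ^ expo * fac) 0 0 0 out) := by
  induction expo generalizing fac with
  | zero =>
    rw [pow_zero, Nat.one_mul]
    exact Run.single fun v => ⟨none, cfg_eq fun k => by cases k <;> rfl⟩
  | succ expo ih =>
    have h1 : Run s d c₀ c₁ c₂ c₃ b₁ b₂ b₃ 1
        .power (conts inp rev len 0 fac 0 0 (expo + 1) out)
        .outer (conts inp rev len 0 fac 0 0 expo out) :=
      Run.single fun v => ⟨some none, cfg_eq fun k => by cases k <;> rfl⟩
    have h2 := h1.trans (run_outer inp rev len 0 fac 0 expo out)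
    have h3 := h2.trans (run_restoreLen inp rev 0 (0 + len) fac 0 (0 + len * fac) expo out)
    have h4 := h3.trans (run_clearFac inp rev (0 + (0 + len)) 0 fac 0 (0 + len * fac) expo out)
    have h5 := h4.trans (run_moveProd inp rev (0 + (0 + len)) 0 0 0 (0 + len * fac) expo out)
    simp only [Nat.zero_add] at h5
    have h6 := h5.trans (ih (len * fac))
    rw [← mul_assoc, ← pow_succ] at h6
    exact h6

theorem flatten_replicate_succ_append (n : ℕ) (b out : List B) :
    (List.replicate (n + 1) b).flatten ++ out = (List.replicate n b).flatten ++ (b ++ out) := by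
  rw [List.replicate_succ', List.flatten_append, List.flatten_singleton, List.append_assoc]

/-- Printing uses up `fac` but saves it in `fac'`, so that the other block is repeated equally
often. -/
theorem run_second (inp rev : List A) (len fac fac' : ℕ) (out : List B) :
    Run s d c₀ c₁ c₂ c₃ b₁ b₂ b₃ (fac + 1)
      .second (conts inp rev len 0 fac fac' 0 0 out)
      .first (conts inp rev len 0 0 (fac' + fac) 0 0
        (c₁ ++ ((List.replicate fac b₂).flatten ++ out))) := by
  induction fac generalizing fac' out with
  | zero =>
    refine Run.single fun v => ⟨none, ?_⟩
    change TM2.stepAux (pushAll .out c₁ (jump .first)) none _ = _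
    rw [stepAux_pushAll]
    exact cfg_eq fun k => by cases k <;> rfl
  | succ fac ih =>
    have := ih (fac' + 1) (b₂ ++ out)
    rw [Nat.add_right_comm fac', ← flatten_replicate_succ_append] at this
    rw [Nat.add_comm (fac + 1) 1]
    refine Run.trans (Run.single fun v => ⟨some none, ?_⟩) this
    change TM2.stepAux (pushAll .out b₂ (jump .second)) (some none) _ = _
    rw [stepAux_pushAll]
    exact cfg_eq fun k => by cases k <;> rfl

theorem run_first (inp rev : List A) (len fac' : ℕ) (out : List B) :
    Run s d c₀ c₁ c₂ c₃ b₁ b₂ b₃ (fac' + 1)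
      .first (conts inp rev len 0 0 fac' 0 0 out)
      .clearLen (conts inp rev len 0 0 0 0 0
        (c₀ ++ ((List.replicate fac' b₁).flatten ++ out))) := by
  induction fac' generalizing out with
  | zero =>
    refine Run.single fun v => ⟨none, ?_⟩
    change TM2.stepAux (pushAll .out c₀ (jump .clearLen)) none _ = _
    rw [stepAux_pushAll]
    exact cfg_eq fun k => by cases k <;> rfl
  | succ fac' ih =>
    have := ih (b₁ ++ out)
    rw [← flatten_replicate_succ_append] at this
    rw [Nat.add_comm (fac' + 1) 1]
    refine Run.trans (Run.single fun v => ⟨some none, ?_⟩) this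
    change TM2.stepAux (pushAll .out b₁ (jump .first)) (some none) _ = _
    rw [stepAux_pushAll]
    exact cfg_eq fun k => by cases k <;> rfl

theorem run_read (inp rev : List A) (len : ℕ) (out : List B) :
    Run s d c₀ c₁ c₂ c₃ b₁ b₂ b₃ (inp.length + 1)
      .read (conts inp rev len 0 0 0 0 0 out)
      .write (conts [] (inp.reverse ++ rev) (s + (len + inp.length)) 0 1 0 0 d (c₃ ++ out)) := by
  induction inp generalizing rev len with
  | nil =>
    refine Run.single fun v => ⟨none, ?_⟩
    change TM2.stepAux (pushAll .len (List.replicate s none) <| pushAll .out c₃ <|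
      pushAll .fac [none] <| pushAll .expo (List.replicate d none) <| jump .write) none _ = _
    rw [stepAux_pushAll, stepAux_pushAll, stepAux_pushAll, stepAux_pushAll]
    refine cfg_eq fun k => ?_
    cases k
    case len => exact List.replicate_append_replicate
    case expo => exact List.append_nil _
    all_goals rfl
  | cons a inp ih =>
    have := ih (a :: rev) (len + 1)
    rw [show len + 1 + inp.length = len + (a :: inp).length by simp; ring] at this
    rw [List.reverse_cons, List.append_assoc, List.singleton_append, List.length_cons,
      Nat.add_comm (inp.length + 1) 1]
    exact Run.trans (Run.single fun v => ⟨some (some a), cfg_eq fun k => by cases k <;> rfl⟩) this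

theorem run_write (inp rev : List A) (len fac expo : ℕ) (out : List B) :
    Run s d c₀ c₁ c₂ c₃ b₁ b₂ b₃ (2 * rev.length + 1)
      .write (conts inp rev len 0 fac 0 0 expo out)
      .power (conts inp [] len 0 fac 0 0 expo (c₂ ++ (rev.reverse.flatMap b₃ ++ out))) := by
  induction rev generalizing out with
  | nil =>
    refine Run.single fun v => ⟨none, ?_⟩
    change TM2.stepAux (pushAll .out c₂ (jump .power)) none _ = _
    rw [stepAux_pushAll]
    exact cfg_eq fun k => by cases k <;> rfl
  | cons a rev ih =>
    have h1 : Run s d c₀ c₁ c₂ c₃ b₁ b₂ b₃ 1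
        .write (conts inp (a :: rev) len 0 fac 0 0 expo out)
        (.emit a) (conts inp rev len 0 fac 0 0 expo out) :=
      Run.single fun v => ⟨some (some a), cfg_eq fun k => by cases k <;> rfl⟩
    have h2 : Run s d c₀ c₁ c₂ c₃ b₁ b₂ b₃ 1
        (.emit a) (conts inp rev len 0 fac 0 0 expo out)
        .write (conts inp rev len 0 fac 0 0 expo (b₃ a ++ out)) := by
      refine Run.single fun v => ⟨v, ?_⟩
      change TM2.stepAux (pushAll .out (b₃ a) (jump .write)) v _ = _
      rw [stepAux_pushAll]
      exact cfg_eq fun k => by cases k <;> rfl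
    have h3 := (h1.trans h2).trans (ih (b₃ a ++ out))
    rw [List.reverse_cons, List.flatMap_append, List.flatMap_singleton, List.append_assoc,
      List.length_cons, show 2 * (rev.length + 1) + 1 = 1 + 1 + (2 * rev.length + 1) by ring]
    exact h3

/-- A halting configuration must have empty stacks apart from the output and the register in its
initial value `none`; the last, unsuccessful pop resets the register. -/
theorem iterate_clearLen (len : ℕ) (out : List B) (v : Option (Option A)) :
    (flip bind (stepFn s d c₀ c₁ c₂ c₃ b₁ b₂ b₃))^[len + 1]
      (some ⟨some .clearLen, v, conts [] [] len 0 0 0 0 0 out⟩) =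
      some ⟨none, none, conts [] [] 0 0 0 0 0 0 out⟩ := by
  induction len generalizing v with
  | zero => exact congrArg some (cfg_eq fun k => by cases k <;> rfl)
  | succ len ih =>
    rw [Function.iterate_succ_apply, ← ih (some none)]
    exact congrArg _ (congrArg some (cfg_eq fun k => by cases k <;> rfl))

/-- The total number of steps. -/
def totalCost {K : Type*} [Semiring K] (s : K) (d : ℕ) (n : K) : K :=
  (s + n + 1) + (((s + n) ^ d + 1) + (((s + n) ^ d + 1) + (powerCost (s + n) d 1 +
    ((2 * n + 1) + (n + 1)))))

theorem iterate_program (w : List A) (v : Option (Option A)) :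
    (flip bind (stepFn s d c₀ c₁ c₂ c₃ b₁ b₂ b₃))^[totalCost s d w.length]
      (some ⟨some .read, v, conts w [] 0 0 0 0 0 0 []⟩) =
      some ⟨none, none, conts [] [] 0 0 0 0 0 0
        (c₀ ++ (List.replicate ((s + w.length) ^ d) b₁).flatten ++ c₁ ++
          (List.replicate ((s + w.length) ^ d) b₂).flatten ++ c₂ ++ w.flatMap b₃ ++ c₃)⟩ := by
  have h1 := run_read (s := s) (d := d) (c₀ := c₀) (c₁ := c₁) (c₂ := c₂) (c₃ := c₃) (b₁ := b₁)
    (b₂ := b₂) (b₃ := b₃) w [] 0 []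
  simp only [List.append_nil, Nat.zero_add] at h1
  have h2 := h1.trans (run_write [] w.reverse (s + w.length) 1 d c₃)
  rw [List.reverse_reverse, List.length_reverse] at h2
  have h3 := h2.trans (run_power [] [] (s + w.length) 1 d _)
  have h4 := h3.trans (run_second [] [] (s + w.length) _ 0 _)
  have h5 := h4.trans (run_first [] [] (s + w.length) _ _)
  rw [Nat.zero_add, Nat.mul_one] at h5
  obtain ⟨v', hv'⟩ := h5 v
  have e : totalCost s d w.length = (s + w.length + 1) + (w.length + 1 + (2 * w.length + 1) +
      powerCost (s + w.length) d 1 + ((s + w.length) ^ d + 1) + ((s + w.length) ^ d + 1)) := by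
    simp only [totalCost]
    ring
  rw [e, Function.iterate_add_apply, hv', iterate_clearLen]
  simp only [List.append_assoc]

/-- The cost makes sense in any semiring, and evaluation respects it. The same expression over
polynomials is thus the required time bound. -/
theorem eval_powerCost (e m : ℕ) (n x : Polynomial ℕ) :
    (powerCost n e x).eval m = powerCost (n.eval m) e (x.eval m) := by
  induction e generalizing x with
  | zero => simp [powerCost]
  | succ e ih => simp [powerCost, ih]

theorem eval_totalCost (s d m : ℕ) :
    (totalCost (s : Polynomial ℕ) d Polynomial.X).eval m = totalCost s d m := by
  simp [totalCost, eval_powerCost]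

variable (s d c₀ c₁ c₂ c₃ b₁ b₂ b₃)

/-- The bundled machine. -/
noncomputable def machine [Finite A] : FinTM2 :=
  have hA : Fintype A := Fintype.ofFinite A
  have : Fintype (Label A) := Fintype.ofFinite _
  { K := Stack
    k₀ := .inp
    k₁ := .out
    Γ := Symb A B
    Λ := Label A
    main := .read
    σ := Option (Option A)
    initialState := none
    Γk₀Fin := hA
    m := program s d c₀ c₁ c₂ c₃ b₁ b₂ b₃ }

end BlockPrinter

open BlockPrinter in
/-- Strings that consist of two fixed blocks repeated polynomially often, of a block for each letter
of the input, and of fixed strings between these parts are computable in polynomial time. -/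
theorem nonempty_tm2ComputableInPolyTime_of_blocks {A B α : Type} [Finite A] {enc : α → List B}
    {f : List A → α} (s d : ℕ) (c₀ c₁ c₂ c₃ b₁ b₂ : List B) (b₃ : A → List B)
    (h : ∀ w, enc (f w) = c₀ ++ (List.replicate ((s + w.length) ^ d) b₁).flatten ++ c₁ ++
      (List.replicate ((s + w.length) ^ d) b₂).flatten ++ c₂ ++ w.flatMap b₃ ++ c₃) :
    Nonempty (Turing.TM2ComputableInPolyTime (fun w : List A => w) enc f) := by
  refine ⟨{
    tm := machine s d c₀ c₁ c₂ c₃ b₁ b₂ b₃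
    inputAlphabet := Equiv.refl A
    outputAlphabet := Equiv.refl B
    time := totalCost (s : Polynomial ℕ) d Polynomial.X
    outputsFun := fun w => ⟨⟨totalCost s d w.length, ?_⟩, (eval_totalCost s d w.length).ge⟩ }⟩
  have key := iterate_program (s := s) (d := d) (c₀ := c₀) (c₁ := c₁) (c₂ := c₂) (c₃ := c₃)
    (b₁ := b₁) (b₂ := b₂) (b₃ := b₃) w none
  rw [← h] at key
  have hin : Turing.initList (machine s d c₀ c₁ c₂ c₃ b₁ b₂ b₃) (w.map (Equiv.refl A).invFun) =
      (⟨some .read, none, conts w [] 0 0 0 0 0 0 []⟩ :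
        Turing.TM2.Cfg (Symb A B) (Label A) (Option (Option A))) := by
    refine cfg_eq fun k => ?_
    cases k
    case inp => exact List.map_id w
    all_goals rfl
  have hout : Turing.haltList (machine s d c₀ c₁ c₂ c₃ b₁ b₂ b₃)
      ((enc (f w)).map (Equiv.refl B).invFun) =
      (⟨none, none, conts [] [] 0 0 0 0 0 0 (enc (f w))⟩ :
        Turing.TM2.Cfg (Symb A B) (Label A) (Option (Option A))) := by
    refine cfg_eq fun k => ?_
    cases k
    case out => exact List.map_id _
    all_goals rfl
  rw [hin]
  refine Eq.trans ?_ (congrArg some hout.symm)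
  exact key

/-! ### The reduction -/

/-- The printer computes only powers `(s + n) ^ d`. An upper bound suffices, since deeper address
trees only enlarge the available part of the grid. -/
theorem exists_eval_le_pow (p : Polynomial ℕ) : ∃ s d : ℕ, ∀ n, p.eval n ≤ (s + n) ^ d := by
  induction p using Polynomial.induction_on' with
  | add p q hp hq =>
    obtain ⟨s, d, hp⟩ := hp
    obtain ⟨t, e, hq⟩ := hq
    refine ⟨s + t + 2, d + e + 1, fun n => ?_⟩
    have h1 : (s + n) ^ d ≤ (s + t + 2 + n) ^ (d + e) :=
      (Nat.pow_le_pow_left (by omega) d).trans (Nat.pow_le_pow_right (by omega) (by omega))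
    have h2 : (t + n) ^ e ≤ (s + t + 2 + n) ^ (d + e) :=
      (Nat.pow_le_pow_left (by omega) e).trans (Nat.pow_le_pow_right (by omega) (by omega))
    rw [Polynomial.eval_add, pow_succ]
    calc p.eval n + q.eval n ≤ (s + t + 2 + n) ^ (d + e) * 2 := by
          linarith [hp n, hq n]
      _ ≤ _ := Nat.mul_le_mul_left _ (by omega)
  | monomial d a =>
    refine ⟨a, d + 1, fun n => ?_⟩
    rw [Polynomial.eval_monomial, pow_succ, mul_comm]
    exact Nat.mul_le_mul (Nat.pow_le_pow_left (by omega) d) (by omega)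

/-- The sentence expressing the existence of an accepting computation, as an instance. -/
noncomputable def computationSentence {d : ℕ} (F : Fin (d + 1) → Fin (d + 1) → Fin (d + 1))
    (β : Fin (d + 1)) (acc : Set (Fin (d + 1))) (k : ℕ) (word : List (Fin (d + 1))) :
    UNFOSentenceOfDepth (treeSig numLab) 2 :=
  ⟨⟨FOFormula.computationS F β acc k word, (FOFormula.ok_computationS F β acc k word).1,
    Finset.subset_empty.1 (FOFormula.ok_computationS F β acc k word).2.1⟩,
    FOFormula.negDepth_computationS F β acc k word⟩

theorem satisfiableIn_computationS {d : ℕ} {F : Fin (d + 1) → Fin (d + 1) → Fin (d + 1)}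
    {β : Fin (d + 1)} {acc : Set (Fin (d + 1))} {k : ℕ} {word : List (Fin (d + 1))}
    {𝒦 : StructureClass (treeSig numLab)} (h𝒦 : ∀ M S, finiteTrees numLab M S → 𝒦 M S) {u v : ℕ}
    (hu : u < 2 ^ 2 ^ k) (hv : v < 2 ^ 2 ^ k) (huv : gridVal F β word u v ∈ acc) :
    SatisfiableIn 𝒦 (FOFormula.computationS F β acc k word) := by
  let n : Bool → ℕ := fun c => bif c then v else u
  have hn : ∀ i, n i < 2 ^ 2 ^ k := fun i => by cases i <;> assumption
  refine ⟨CompTree k (gridVal F β word) n, _, h𝒦 _ _ (CompTree.finiteTrees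
    fun l x => x.state.HasLab k (gridVal F β word) l), fun _ => CompTree.root, ?_⟩
  refine (FOFormula.realize_computationS (S := graphStructure _ _)).2 ?_
  rw [isChild_graphStructure, hasLabel_graphStructure]
  exact CompTree.isUnfolding.isComputation hn huv

theorem exists_gridVal_mem_of_satisfiableIn {d : ℕ} {F : Fin (d + 1) → Fin (d + 1) → Fin (d + 1)}
    {β : Fin (d + 1)} {acc : Set (Fin (d + 1))} {k : ℕ} {word : List (Fin (d + 1))}
    {𝒦 : StructureClass (treeSig numLab)}
    (h : SatisfiableIn 𝒦 (FOFormula.computationS F β acc k word)) :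
    ∃ u v, gridVal F β word u v ∈ acc := by
  obtain ⟨M, S, -, v, hv⟩ := h
  exact (FOFormula.realize_computationS.1 hv).exists_gridVal_mem

/-- Each language in 2EXPTIME reduces in polynomial time to the satisfiability of sentences of
negation depth `2`, simultaneously for all classes that contain all finite trees. -/
theorem InTwoExpTime.exists_reduction {A : Type} [Finite A] {L : Language A}
    (hL : InTwoExpTime L) : ∃ f : List A → UNFOSentenceOfDepth (treeSig numLab) 2,
      Nonempty (Turing.TM2ComputableInPolyTime (fun w : List A => w)
        (fun φ : UNFOSentenceOfDepth (treeSig numLab) 2 => φ.1.1.encode) f) ∧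
      Nonempty (Turing.TM2ComputableInPolyTime (fun w : List A => w)
        (fun φ : UNFOSentence (treeSig numLab) => φ.1.encode) fun w => (f w).1) ∧
      ∀ 𝒦 : StructureClass (treeSig numLab), (∀ M S, finiteTrees numLab M S → 𝒦 M S) →
        ∀ w, w ∈ L ↔ SatisfiableIn 𝒦 (f w).1.1 := by
  obtain ⟨d, F, β, pre, letter, acc, p, h⟩ := hL.exists_grid
  obtain ⟨s, e, hp⟩ := exists_eval_le_pow p
  obtain ⟨c₀, c₁, c₂, c₃, b₁, b₂, b₃, henc⟩ := FOFormula.exists_encode_computationS F β acc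
  have henc' : ∀ w : List A,
      (FOFormula.computationS F β acc ((s + w.length) ^ e) (pre ++ w.map letter)).encode =
        c₀ ++ (List.replicate ((s + w.length) ^ e) b₁).flatten ++ c₁ ++
        (List.replicate ((s + w.length) ^ e) b₂).flatten ++ (c₂ ++ pre.flatMap b₃) ++
        w.flatMap (fun a => b₃ (letter a)) ++ c₃ := fun w => by
    rw [henc, List.flatMap_append, List.flatMap_map]
    simp only [List.append_assoc]
  refine ⟨fun w => computationSentence F β acc ((s + w.length) ^ e) (pre ++ w.map letter),
    nonempty_tm2ComputableInPolyTime_of_blocks s e _ _ _ _ _ _ _ henc',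
    nonempty_tm2ComputableInPolyTime_of_blocks s e _ _ _ _ _ _ _ henc', fun 𝒦 h𝒦 w => ?_⟩
  constructor
  · intro hw
    obtain ⟨u, v, hu, hv, huv⟩ := (h w).2 hw
    have hle : 2 ^ 2 ^ p.eval w.length ≤ 2 ^ 2 ^ (s + w.length) ^ e :=
      Nat.pow_le_pow_right (by norm_num) (Nat.pow_le_pow_right (by norm_num) (hp w.length))
    exact satisfiableIn_computationS h𝒦 (hu.trans_le hle) (hv.trans_le hle) huv
  -- The bound plays no role here: an accepting entry anywhere in the grid implies membership.
  · intro hs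
    obtain ⟨u, v, huv⟩ := exists_gridVal_mem_of_satisfiableIn hs
    exact (h w).1 u v huv

theorem unfoSatHard_of_finiteTrees {𝒦 : StructureClass (treeSig numLab)}
    (h𝒦 : ∀ M S, finiteTrees numLab M S → 𝒦 M S) : UNFOSatHard 𝒦 := fun _ _ _ hL => by
  obtain ⟨f, -, hf, h⟩ := hL.exists_reduction
  exact ⟨_, hf, h 𝒦 h𝒦⟩

theorem unfoSatHardAtDepth_two_of_finiteTrees {𝒦 : StructureClass (treeSig numLab)}
    (h𝒦 : ∀ M S, finiteTrees numLab M S → 𝒦 M S) : UNFOSatHardAtDepth 2 𝒦 := fun _ _ _ hL => by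
  obtain ⟨f, hf, -, h⟩ := hL.exists_reduction
  exact ⟨f, hf, h 𝒦 h𝒦⟩

end UnaryNegation

theorem mainTheorem2 :
    ∃ m : ℕ,
      UnaryNegation.UNFOSatHard (UnaryNegation.allStructures (UnaryNegation.treeSig m)) ∧
      UnaryNegation.UNFOSatHard (UnaryNegation.finiteStructures (UnaryNegation.treeSig m)) ∧
      UnaryNegation.UNFOSatHard (UnaryNegation.finiteTrees m) ∧
      ∀ 𝒦 : UnaryNegation.StructureClass (UnaryNegation.treeSig m),
        (∀ M S, UnaryNegation.finiteTrees m M S → 𝒦 M S) →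
          UnaryNegation.UNFOSatHardAtDepth 2 𝒦 :=
  ⟨UnaryNegation.numLab,
    -- The root of a tree witnesses that the domain is nonempty.
    UnaryNegation.unfoSatHard_of_finiteTrees fun _ _ h => ⟨h.2.choose⟩,
    UnaryNegation.unfoSatHard_of_finiteTrees fun _ _ h => ⟨⟨h.2.choose⟩, h.1⟩,
    UnaryNegation.unfoSatHard_of_finiteTrees fun _ _ h => h,
    fun _ h𝒦 => UnaryNegation.unfoSatHardAtDepth_two_of_finiteTrees h𝒦⟩
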